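/- Let $k$ be a field of characteristic $0$. An operad over $k$ is a collection of vector spaces $P(n)$, $n\ge 1$, with an action of the symmetric group $S_n$ on $P(n)$, bilinear partial compositions $\circ_i : P(n)\times P(m)\to P(n+m-1)$ ($1\le i\le n$) and a unit $1\in P(1)$, that are associative, unital and equivariant; an isomorphism of operads is an invertible family of linear maps $P(n)\to Q(n)$ that preserves the unit, the partial compositions and the symmetric group actions. For a finite-dimensional $S_2$-module $E$, let $\mathrm{Free}(E)$ be the free operad on $E$: $\mathrm{Free}(E)(n)$ is spanned by binary trees with vertices decorated by elements of $E$ and with $n$ leaves labelled bijectively by $1,\dots,n$, modulo linearity in each decoration and equivariance at each vertex; $S_n$ permutes the labels, and composition is grafting. For an $S_3$-submodule $R\subset \mathrm{Free}(E)(3)$ let $\mathcal Q(E,R)=\mathrm{Free}(E)/\langle R\rangle$, where $\langle R\rangle$ is the operadic ideal generated by $R$. For decorations $\alpha,\beta$ and $\sigma\in S_3$, write $\alpha(\beta(\sigma(1),\sigma(2)),\sigma(3))$ and $\alpha(\sigma(1),\beta(\sigma(2),\sigma(3)))$ for the two kinds of labelled planar trees with two vertices. Let * $\mathcal{A}ss$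 be generated by two elements $\mu,\mu'$ interchanged by $(12)$, with the associativity relations $\mu(\mu(\sigma(1),\sigma(2)),\sigma(3))-\mu(\sigma(1),\mu(\sigma(2),\sigma(3)))$, $\sigma\in S_3$; * $\mathcal{C}om$ be generated by one element $c$ with $(12)c=c$, with the associativity relations for $c$; * $\mathcal{L}ie$ be generated by one element $\ell$ with $(12)\ell=-\ell$, with the Jacobi relation $\ell(1,\ell(2,3))+\ell(2,\ell(3,1))+\ell(3,\ell(1,2))$; * $\mathcal{P}oiss$ be generated by $c$ and $\ell$ with $(12)c=c$ and $(12)\ell=-\ell$, with the associativity relations for $c$, the Jacobi relation for $\ell$, and the distributivity relation $\ell(1,c(2,3))-c(2,\ell(1,3))-c(\ell(1,2),3)$ in all labellings. The dual of an $S_n$-module $V$ is $V^\vee=V^*\otimes \mathrm{sgn}$, that is, $V^*$ with the action $\sigma(\alpha)=\mathrm{sgn}(\sigma)\,\alpha\circ\sigma^{-1}$. Identify $\mathrm{Free}(E^\vee)(3)$ with $\mathrm{Free}(E)^\vee(3)$ by the bilinear pairing in which, for $\alpha,\beta\in E^\vee$, $\mu,\nu\in E$ and $\sigma\in S_3$,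 the trees $\alpha(\beta(\sigma(1),\sigma(2)),\sigma(3))$ and $\mu(\nu(\sigma(1),\sigma(2)),\sigma(3))$ have pairing $\mathrm{sgn}(\sigma)\,\alpha(\mu)\beta(\nu)$, the trees $\alpha(\sigma(1),\beta(\sigma(2),\sigma(3)))$ and $\mu(\sigma(1),\nu(\sigma(2),\sigma(3)))$ have pairing $-\mathrm{sgn}(\sigma)\,\alpha(\mu)\beta(\nu)$, and trees in which different leaves are attached directly to the root vertex have pairing $0$. The quadratic dual of $\mathcal Q(E,R)$ is $\mathcal Q(E,R)^!=\mathcal Q(E^\vee,\mathrm{Ann}(R))$, where $\mathrm{Ann}(R)\subset\mathrm{Free}(E^\vee)(3)$ is the annihilator of $R$ under this identification. Then, as operads, $\mathcal{A}ss^!\cong\mathcal{A}ss$, $\mathcal{C}om^!\cong\mathcal{L}ie$, $\mathcal{L}ie^!\cong\mathcal{C}om$ and $\mathcal{P}oiss^!\cong\mathcal{P}oiss$. -/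

import Mathlib

/-!
Symmetric operads over a field, free operads on a binary generating `S_2`-module (by decorated
trees), operadic ideals and quotients, quadratic operads, quadratic duals, and the operads
`Ass`, `Com`, `Lie`, `Poiss`.
-/

namespace QuadOperad

open Equiv

universe u v w

/-! ### Positions of inputs in a partial composition

Inputs are numbered from `0`.  If `μ` (with `m` inputs) is plugged into the `i`-th input of `ν`
(with `n` inputs), then the result has `N = n + m - 1` inputs; this is written `N + 1 = n + m`. -/

/-- The position in `ν ∘_i μ` of the input `j` of `μ`. -/
def inner {n m N : ℕ} (h : N + 1 = n + m) (i : Fin n) (j : Fin m) : Fin N :=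
  ⟨i + j, by omega⟩

/-- The position in `ν ∘_i μ` of the input `j ≠ i` of `ν`. -/
def outer {n m N : ℕ} (h : N + 1 = n + m) (i j : Fin n) (hj : j ≠ i) : Fin N :=
  ⟨if (j : ℕ) < (i : ℕ) then j else j + m - 1, by
    have : (j : ℕ) ≠ i := fun e => hj (Fin.ext e)
    split_ifs <;> omega⟩

/-- All inputs of `ν ∘_i μ`: those of `ν` other than `i`, and those of `μ`. -/
def inputs {n m N : ℕ} (h : N + 1 = n + m) (i : Fin n) : {j : Fin n // j ≠ i} ⊕ Fin m → Fin N :=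
  Sum.elim (fun j => outer h i j.1 j.2) (inner h i)

theorem inputs_bijective {n m N : ℕ} (h : N + 1 = n + m) (i : Fin n) :
    Function.Bijective (inputs h i) := by
  constructor
  · rintro (⟨a, ha⟩ | a) (⟨b, hb⟩ | b) hab
    all_goals
      have hab := congrArg Fin.val hab
      simp only [inputs, Sum.elim_inl, Sum.elim_inr, outer, inner] at hab
      have := a.2
      have := b.2
      have := i.2
    · have ha := Fin.val_ne_of_ne ha
      have hb := Fin.val_ne_of_ne hb
      have : a = b := Fin.ext (by split_ifs at hab <;> omega)
      simp [this]
    · have ha := Fin.val_ne_of_ne ha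
      exfalso
      split_ifs at hab <;> omega
    · have hb := Fin.val_ne_of_ne hb
      exfalso
      split_ifs at hab <;> omega
    · have : a = b := Fin.ext (by omega)
      simp [this]
  · intro x
    have hx := x.2
    have hi := i.2
    by_cases h1 : (x : ℕ) < i
    · refine ⟨Sum.inl ⟨⟨x, by omega⟩, fun e => ?_⟩, ?_⟩
      · have := congrArg Fin.val e
        simp at this
        omega
      · exact Fin.ext (if_pos h1)
    · by_cases h2 : (x : ℕ) < i + m
      · exact ⟨Sum.inr ⟨x - i, by omega⟩, by
          apply Fin.ext
          simp only [inputs, inner, Sum.elim_inr]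
          omega⟩
      · refine ⟨Sum.inl ⟨⟨x + 1 - m, by omega⟩, fun e => ?_⟩, ?_⟩
        · have := congrArg Fin.val e
          simp at this
          omega
        · apply Fin.ext
          simp only [inputs, outer, Sum.elim_inl]
          split_ifs <;> omega

/-- `inputs` as an equivalence. -/
noncomputable def inputsEquiv {n m N : ℕ} (h : N + 1 = n + m) (i : Fin n) :
    {j : Fin n // j ≠ i} ⊕ Fin m ≃ Fin N :=
  Equiv.ofBijective (inputs h i) (inputs_bijective h i)

/-- The permutation of the inputs of a partial composition that is induced by a permutation `σ` of
the inputs of the outer operation and a permutation `τ` of the inputs of the inner operation: it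
sends the inputs of `ν ∘_i μ` to those of `ν' ∘_{σ i} μ'`. -/
noncomputable def blockPerm {n m N : ℕ} (h : N + 1 = n + m) (i : Fin n)
    (σ : Perm (Fin n)) (τ : Perm (Fin m)) : Perm (Fin N) :=
  (inputsEquiv h i).symm.trans
    ((Equiv.sumCongr (σ.subtypeEquiv fun a => by simp) τ).trans (inputsEquiv h (σ i)))

theorem blockPerm_outer {n m N : ℕ} (h : N + 1 = n + m) (i : Fin n)
    (σ : Perm (Fin n)) (τ : Perm (Fin m)) (j : Fin n) (hj : j ≠ i) :
    blockPerm h i σ τ (outer h i j hj) = outer h (σ i) (σ j) (by simpa using hj) := by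
  have : outer h i j hj = inputsEquiv h i (Sum.inl ⟨j, hj⟩) := rfl
  rw [this]
  simp [blockPerm]
  rfl

theorem blockPerm_inner {n m N : ℕ} (h : N + 1 = n + m) (i : Fin n)
    (σ : Perm (Fin n)) (τ : Perm (Fin m)) (j : Fin m) :
    blockPerm h i σ τ (inner h i j) = inner h (σ i) (τ j) := by
  have : inner h i j = inputsEquiv h i (Sum.inr j) := rfl
  rw [this]
  simp [blockPerm]
  rfl

/-! ### Operads -/

/-- A symmetric operad over a field `k`, with operations in arities `n ≥ 1` (the arity `0` part
is zero), given by its partial compositions `circ _ i ν μ = ν ∘_i μ`. -/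
structure Operad (k : Type u) [Field k] where
  /-- The vector space `P(n)` of operations with `n` inputs. -/
  obj : ℕ → Type v
  [addCommGroup : ∀ n, AddCommGroup (obj n)]
  [module : ∀ n, Module k (obj n)]
  /-- There are no operations without inputs. -/
  subsingleton_zero : Subsingleton (obj 0)
  /-- The action of the symmetric groups. -/
  act : ∀ n, Representation k (Perm (Fin n)) (obj n)
  /-- The unit. -/
  one : obj 1
  /-- The partial compositions `ν ∘_i μ`, bilinear in `ν` and `μ`. -/
  circ : ∀ {n m N : ℕ}, N + 1 = n + m → Fin n → obj n →ₗ[k] obj m →ₗ[k] obj N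
  one_circ : ∀ {m : ℕ} (h : m + 1 = 1 + m) (μ : obj m), circ h 0 one μ = μ
  circ_one : ∀ {n : ℕ} (h : n + 1 = n + 1) (i : Fin n) (ν : obj n), circ h i ν one = ν
  /-- `(ν ∘_i μ) ∘_j κ = ν ∘_i (μ ∘_j κ)` where `j` is an input of `μ`. -/
  circ_assoc : ∀ {n m l N₁ N₂ N : ℕ} (h₁ : N₁ + 1 = n + m) (h : N + 1 = N₁ + l)
    (h₂ : N₂ + 1 = m + l) (h' : N + 1 = n + N₂) (i : Fin n) (j : Fin m)
    (ν : obj n) (μ : obj m) (κ : obj l),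
    circ h (inner h₁ i j) (circ h₁ i ν μ) κ = circ h' i ν (circ h₂ j μ κ)
  /-- `(ν ∘_i μ) ∘_j κ = (ν ∘_j κ) ∘_i μ` where `i ≠ j` are inputs of `ν`. -/
  circ_comm : ∀ {n m l N₁ N₂ N : ℕ} (h₁ : N₁ + 1 = n + m) (h : N + 1 = N₁ + l)
    (h₂ : N₂ + 1 = n + l) (h' : N + 1 = N₂ + m) (i j : Fin n) (hij : i ≠ j)
    (ν : obj n) (μ : obj m) (κ : obj l),
    circ h (outer h₁ i j hij.symm) (circ h₁ i ν μ) κ =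
      circ h' (outer h₂ j i hij) (circ h₂ j ν κ) μ
  /-- Equivariance of the partial compositions. -/
  act_circ : ∀ {n m N : ℕ} (h : N + 1 = n + m) (i : Fin n) (σ : Perm (Fin n))
    (τ : Perm (Fin m)) (ν : obj n) (μ : obj m),
    circ h (σ i) (act n σ ν) (act m τ μ) = act N (blockPerm h i σ τ) (circ h i ν μ)

attribute [instance] Operad.addCommGroup Operad.module

/-- Homomorphisms of operads. -/
structure Operad.Hom {k : Type u} [Field k] (P : Operad.{u, v} k) (Q : Operad.{u, w} k) where
  toFun : ∀ n, P.obj n →ₗ[k] Q.obj n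
  map_one : toFun 1 P.one = Q.one
  map_circ : ∀ {n m N : ℕ} (h : N + 1 = n + m) (i : Fin n) (ν : P.obj n) (μ : P.obj m),
    toFun N (P.circ h i ν μ) = Q.circ h i (toFun n ν) (toFun m μ)
  map_act : ∀ (n : ℕ) (σ : Perm (Fin n)) (ν : P.obj n),
    toFun n (P.act n σ ν) = Q.act n σ (toFun n ν)

/-- Isomorphisms of operads: mutually inverse homomorphisms. -/
structure Operad.Iso {k : Type u} [Field k] (P : Operad.{u, v} k) (Q : Operad.{u, w} k) where
  hom : Operad.Hom P Q
  inv : Operad.Hom Q P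
  inv_hom : ∀ n x, inv.toFun n (hom.toFun n x) = x
  hom_inv : ∀ n x, hom.toFun n (inv.toFun n x) = x

/-! ### Ideals and quotients -/

/-- An ideal of an operad. -/
structure Operad.Ideal {k : Type u} [Field k] (P : Operad.{u, v} k) where
  carrier : ∀ n, Submodule k (P.obj n)
  act_mem : ∀ (n : ℕ) (σ : Perm (Fin n)) (ν : P.obj n), ν ∈ carrier n → P.act n σ ν ∈ carrier n
  circ_mem_left : ∀ {n m N : ℕ} (h : N + 1 = n + m) (i : Fin n) (ν : P.obj n) (μ : P.obj m),
    ν ∈ carrier n → P.circ h i ν μ ∈ carrier N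
  circ_mem_right : ∀ {n m N : ℕ} (h : N + 1 = n + m) (i : Fin n) (ν : P.obj n) (μ : P.obj m),
    μ ∈ carrier m → P.circ h i ν μ ∈ carrier N

/-- The ideal generated by a set of operations with `r` inputs: the smallest ideal that
contains it. -/
def Operad.Ideal.generatedBy {k : Type u} [Field k] (P : Operad.{u, v} k) {r : ℕ}
    (R : Set (P.obj r)) : P.Ideal where
  carrier n := ⨅ (I : P.Ideal) (_ : R ⊆ I.carrier r), I.carrier n
  act_mem n σ ν hν := by
    simp only [Submodule.mem_iInf] at hν ⊢
    exact fun I hI => I.act_mem n σ ν (hν I hI)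
  circ_mem_left h i ν μ hν := by
    simp only [Submodule.mem_iInf] at hν ⊢
    exact fun I hI => I.circ_mem_left h i ν μ (hν I hI)
  circ_mem_right h i ν μ hμ := by
    simp only [Submodule.mem_iInf] at hμ ⊢
    exact fun I hI => I.circ_mem_right h i ν μ (hμ I hI)

/-- The partial compositions on `P / I`, induced by those on `P`. -/
def Operad.Ideal.quotientCirc {k : Type u} [Field k] {P : Operad.{u, v} k} (I : P.Ideal)
    {n m N : ℕ} (h : N + 1 = n + m) (i : Fin n) :
    (P.obj n ⧸ I.carrier n) →ₗ[k] (P.obj m ⧸ I.carrier m) →ₗ[k] (P.obj N ⧸ I.carrier N) :=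
  (I.carrier n).liftQ
    { toFun := fun ν => (I.carrier m).mapQ (I.carrier N) (P.circ h i ν)
        fun μ => I.circ_mem_right h i ν μ
      map_add' := fun ν ν' => by
        apply Submodule.linearMap_qext
        ext
        simp
      map_smul' := fun c ν => by
        apply Submodule.linearMap_qext
        ext
        simp }
    (fun ν hν => by
      rw [LinearMap.mem_ker]
      apply Submodule.linearMap_qext
      ext μ
      simpa using I.circ_mem_left h i ν μ hν)

theorem Operad.Ideal.quotientCirc_mk {k : Type u} [Field k] {P : Operad.{u, v} k} (I : P.Ideal)
    {n m N : ℕ} (h : N + 1 = n + m) (i : Fin n) (ν : P.obj n) (μ : P.obj m) :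
    I.quotientCirc h i (Submodule.Quotient.mk ν) (Submodule.Quotient.mk μ) =
      Submodule.Quotient.mk (P.circ h i ν μ) := rfl

/-- The quotient of an operad by an ideal, `(P / I)(n) = P(n) / I(n)`. -/
def Operad.quotient {k : Type u} [Field k] (P : Operad.{u, v} k) (I : P.Ideal) :
    Operad.{u, v} k where
  obj n := P.obj n ⧸ I.carrier n
  subsingleton_zero := by
    have := P.subsingleton_zero
    exact (Submodule.mkQ_surjective (I.carrier 0)).subsingleton
  act n :=
    { toFun := fun σ => (I.carrier n).mapQ (I.carrier n) (P.act n σ) fun ν => I.act_mem n σ ν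
      map_one' := by
        apply Submodule.linearMap_qext
        ext
        simp
      map_mul' := fun σ τ => by
        apply Submodule.linearMap_qext
        ext
        simp }
  one := Submodule.Quotient.mk P.one
  circ h i := I.quotientCirc h i
  one_circ h μ := by
    obtain ⟨μ, rfl⟩ := Submodule.Quotient.mk_surjective _ μ
    exact congrArg (I.carrier _).mkQ (P.one_circ h μ)
  circ_one h i ν := by
    obtain ⟨ν, rfl⟩ := Submodule.Quotient.mk_surjective _ ν
    exact congrArg (I.carrier _).mkQ (P.circ_one h i ν)
  circ_assoc h₁ h h₂ h' i j ν μ κ := by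
    obtain ⟨ν, rfl⟩ := Submodule.Quotient.mk_surjective _ ν
    obtain ⟨μ, rfl⟩ := Submodule.Quotient.mk_surjective _ μ
    obtain ⟨κ, rfl⟩ := Submodule.Quotient.mk_surjective _ κ
    simp only [Operad.Ideal.quotientCirc_mk]
    exact congrArg _ (P.circ_assoc h₁ h h₂ h' i j ν μ κ)
  circ_comm h₁ h h₂ h' i j hij ν μ κ := by
    obtain ⟨ν, rfl⟩ := Submodule.Quotient.mk_surjective _ ν
    obtain ⟨μ, rfl⟩ := Submodule.Quotient.mk_surjective _ μ
    obtain ⟨κ, rfl⟩ := Submodule.Quotient.mk_surjective _ κ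
    simp only [Operad.Ideal.quotientCirc_mk]
    exact congrArg _ (P.circ_comm h₁ h h₂ h' i j hij ν μ κ)
  act_circ h i σ τ ν μ := by
    obtain ⟨ν, rfl⟩ := Submodule.Quotient.mk_surjective _ ν
    obtain ⟨μ, rfl⟩ := Submodule.Quotient.mk_surjective _ μ
    exact congrArg (I.carrier _).mkQ (P.act_circ h i σ τ ν μ)

/-! ### Decorated binary trees -/

/-- Planar binary trees, with vertices decorated by `E` and leaves labelled by `X`.
The leaf is the trivial tree. -/
inductive DTree (E : Type v) (X : Type w) : Type (max v w)
  | leaf (x : X) : DTree E X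
  | node (e : E) (l r : DTree E X) : DTree E X

namespace DTree

variable {E : Type v} {X : Type w}

/-- The labels of the leaves, with multiplicities. -/
def leaves : DTree E X → Multiset X
  | leaf x => {x}
  | node _ l r => leaves l + leaves r

/-- Graft the tree `f x` onto each leaf labelled `x`. -/
def subst {Y : Type*} (f : X → DTree E Y) : DTree E X → DTree E Y
  | leaf x => f x
  | node e l r => node e (subst f l) (subst f r)

/-- Change the labels of the leaves. -/
def relabel {Y : Type*} (f : X → Y) (t : DTree E X) : DTree E Y :=
  t.subst fun x => leaf (f x)

/-- `LinRel a b t t₁ t₂`: the three trees agree except at one vertex, whose decoration in `t` is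
`a e₁ + b e₂`, where `e₁` and `e₂` are the decorations of that vertex in `t₁` and in `t₂`. -/
inductive LinRel {k : Type u} [Field k] [AddCommGroup E] [Module k E] (a b : k) :
    DTree E X → DTree E X → DTree E X → Prop
  | root (e₁ e₂ : E) (l r : DTree E X) :
      LinRel a b (node (a • e₁ + b • e₂) l r) (node e₁ l r) (node e₂ l r)
  | left {t t₁ t₂ : DTree E X} (e : E) (r : DTree E X) :
      LinRel a b t t₁ t₂ → LinRel a b (node e t r) (node e t₁ r) (node e t₂ r)
  | right {t t₁ t₂ : DTree E X} (e : E) (l : DTree E X) :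
      LinRel a b t t₁ t₂ → LinRel a b (node e l t) (node e l t₁) (node e l t₂)

/-- `SwapRel ρ t t'`: the two trees agree except at one vertex; that vertex has decoration
`(12) e` in `t`, and decoration `e` and its two inputs interchanged in `t'`. -/
inductive SwapRel {k : Type u} [Field k] [AddCommGroup E] [Module k E]
    (ρ : Representation k (Perm (Fin 2)) E) : DTree E X → DTree E X → Prop
  | root (e : E) (l r : DTree E X) :
      SwapRel ρ (node (ρ (Equiv.swap 0 1) e) l r) (node e r l)
  | left {t t' : DTree E X} (e : E) (r : DTree E X) :
      SwapRel ρ t t' → SwapRel ρ (node e t r) (node e t' r)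
  | right {t t' : DTree E X} (e : E) (l : DTree E X) :
      SwapRel ρ t t' → SwapRel ρ (node e l t) (node e l t')

section lemmas

variable {Y : Type*} {Z : Type*}

theorem subst_subst (f : X → DTree E Y) (g : Y → DTree E Z) (t : DTree E X) :
    (t.subst f).subst g = t.subst fun x => (f x).subst g := by
  induction t with
  | leaf x => rfl
  | node e l r hl hr => simp [subst, hl, hr]

theorem subst_leaf (t : DTree E X) : t.subst leaf = t := by
  induction t with
  | leaf x => rfl
  | node e l r hl hr => simp [subst, hl, hr]

theorem leaves_subst (f : X → DTree E Y) (t : DTree E X) :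
    (t.subst f).leaves = t.leaves.bind fun x => (f x).leaves := by
  induction t with
  | leaf x => simp [subst, leaves]
  | node e l r hl hr => simp [subst, leaves, hl, hr]

theorem leaves_relabel (f : X → Y) (t : DTree E X) :
    (t.relabel f).leaves = t.leaves.map f := by
  rw [relabel, leaves_subst]
  simp [leaves, Multiset.bind_singleton]

variable {k : Type u} [Field k] [AddCommGroup E] [Module k E]
  {ρ : Representation k (Perm (Fin 2)) E} {a b : k}

theorem LinRel.subst (f : X → DTree E Y) {t t₁ t₂ : DTree E X} (h : LinRel a b t t₁ t₂) :
    LinRel a b (t.subst f) (t₁.subst f) (t₂.subst f) := by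
  induction h with
  | root e₁ e₂ l r => exact .root ..
  | left e r _ ih => exact .left _ _ ih
  | right e l _ ih => exact .right _ _ ih

theorem SwapRel.subst (f : X → DTree E Y) {t t' : DTree E X} (h : SwapRel ρ t t') :
    SwapRel ρ (t.subst f) (t'.subst f) := by
  induction h with
  | root e l r => exact .root ..
  | left e r _ ih => exact .left _ _ ih
  | right e l _ ih => exact .right _ _ ih

theorem subst_congr_of_count {E : Type v} [DecidableEq X] {f g : X → DTree E Y} {i : X}
    (hfg : ∀ x, x ≠ i → f x = g x) {t : DTree E X} (ht : t.leaves.count i = 0) :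
    t.subst f = t.subst g := by
  induction t with
  | leaf x =>
    refine hfg x fun e => ?_
    simp [leaves, e] at ht
  | node e l r hl hr =>
    simp only [leaves, Multiset.count_add, Nat.add_eq_zero_iff] at ht
    simp [DTree.subst, hl ht.1, hr ht.2]

theorem LinRel.subst_right [DecidableEq X] {f f₁ f₂ : X → DTree E Y} {i : X}
    (h₁ : ∀ x, x ≠ i → f x = f₁ x) (h₂ : ∀ x, x ≠ i → f x = f₂ x)
    (hi : LinRel a b (f i) (f₁ i) (f₂ i)) {t : DTree E X} (ht : t.leaves.count i = 1) :
    LinRel a b (t.subst f) (t.subst f₁) (t.subst f₂) := by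
  induction t with
  | leaf x =>
    have : x = i := by
      by_contra e
      simp [leaves, Ne.symm e] at ht
    exact this ▸ hi
  | node e l r hl hr =>
    simp only [leaves, Multiset.count_add] at ht
    obtain ⟨h0, h0'⟩ | ⟨h0, h0'⟩ : (l.leaves.count i = 1 ∧ r.leaves.count i = 0) ∨
      (l.leaves.count i = 0 ∧ r.leaves.count i = 1) := by omega
    · have := LinRel.left (k := k) e (r.subst f) (hl h0)
      simp only [DTree.subst]
      rwa [← subst_congr_of_count h₁ h0', ← subst_congr_of_count h₂ h0']
    · have := LinRel.right (k := k) e (l.subst f) (hr h0')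
      simp only [DTree.subst]
      rwa [← subst_congr_of_count h₁ h0, ← subst_congr_of_count h₂ h0]

theorem SwapRel.subst_right [DecidableEq X] {f f₁ : X → DTree E Y} {i : X}
    (h₁ : ∀ x, x ≠ i → f x = f₁ x)
    (hi : SwapRel ρ (f i) (f₁ i)) {t : DTree E X} (ht : t.leaves.count i = 1) :
    SwapRel ρ (t.subst f) (t.subst f₁) := by
  induction t with
  | leaf x =>
    have : x = i := by
      by_contra e
      simp [leaves, Ne.symm e] at ht
    exact this ▸ hi
  | node e l r hl hr =>
    simp only [leaves, Multiset.count_add] at ht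
    obtain ⟨h0, h0'⟩ | ⟨h0, h0'⟩ : (l.leaves.count i = 1 ∧ r.leaves.count i = 0) ∨
      (l.leaves.count i = 0 ∧ r.leaves.count i = 1) := by omega
    · have := SwapRel.left e (r.subst f) (hl h0)
      simp only [DTree.subst]
      rwa [← subst_congr_of_count h₁ h0']
    · have := SwapRel.right e (l.subst f) (hr h0')
      simp only [DTree.subst]
      rwa [← subst_congr_of_count h₁ h0]

end lemmas

end DTree

/-- Binary trees with vertices decorated by `E` and with `n` leaves, labelled bijectively by
`Fin n`. -/
def LTree (E : Type v) (n : ℕ) : Type v :=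
  {t : DTree E (Fin n) // ∀ x, t.leaves.count x = 1}

namespace LTree

variable {E : Type v}

@[ext] theorem ext {n : ℕ} {s t : LTree E n} (h : s.1 = t.1) : s = t := Subtype.ext h

theorem leaves_eq {n : ℕ} (t : LTree E n) : t.1.leaves = (Finset.univ : Finset (Fin n)).val := by
  ext x
  rw [t.2 x, Multiset.count_eq_one_of_mem Finset.univ.nodup (Finset.mem_univ x)]

/-- The trivial tree. -/
def one : LTree E 1 := ⟨.leaf 0, fun x => by simp [DTree.leaves, Fin.eq_zero x]⟩

/-- Permute the labels of the leaves. -/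
def perm {n : ℕ} (σ : Perm (Fin n)) (t : LTree E n) : LTree E n :=
  ⟨t.1.relabel σ, fun x => by
    obtain ⟨y, rfl⟩ := σ.surjective x
    rw [DTree.leaves_relabel, Multiset.count_map_eq_count' _ _ σ.injective, t.2]⟩

/-- What is grafted onto the leaves of the outer tree when forming `t ∘_i s`: the tree `s` onto the
leaf `i`, and trivial trees onto the other leaves, all with the leaves renumbered. -/
def grafts {n m N : ℕ} (h : N + 1 = n + m) (i : Fin n) (s : DTree E (Fin m)) (j : Fin n) :
    DTree E (Fin N) :=
  if hj : j = i then s.relabel (inner h i) else .leaf (outer h i j hj)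

theorem grafts_self {n m N : ℕ} (h : N + 1 = n + m) (i : Fin n) (s : DTree E (Fin m)) :
    grafts h i s i = s.relabel (inner h i) := by simp [grafts]

theorem grafts_ne {n m N : ℕ} (h : N + 1 = n + m) (i : Fin n) (s : DTree E (Fin m)) (j : Fin n)
    (hj : j ≠ i) : grafts h i s j = .leaf (outer h i j hj) := by simp [grafts, hj]

/-- Paste the root of `s` to the leaf of `t` with label `i`. -/
def circ {n m N : ℕ} (h : N + 1 = n + m) (i : Fin n) (t : LTree E n) (s : LTree E m) :
    LTree E N :=
  ⟨t.1.subst (grafts h i s.1), fun x => by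
    rw [DTree.leaves_subst, t.leaves_eq, Multiset.count_bind]
    change ∑ j : Fin n, _ = _
    rw [← Finset.add_sum_erase _ _ (Finset.mem_univ i), grafts_self, DTree.leaves_relabel]
    rw [Finset.sum_congr rfl (g := fun j => if hj : j ≠ i then
      (if x = outer h i j hj then 1 else 0) else 0) (fun j hj => by
        have hj := (Finset.mem_erase.1 hj).1
        simp [grafts_ne h i s.1 j hj, DTree.leaves, Multiset.count_singleton, hj])]
    have hinj := (inputs_bijective h i).1
    obtain ⟨(⟨j, hj⟩ | j), rfl⟩ := (inputs_bijective h i).2 x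
    · rw [Multiset.count_eq_zero_of_notMem, zero_add, Finset.sum_eq_single j]
      · simp [hj, inputs]
      · intro b hb hbj
        have hb := (Finset.mem_erase.1 hb).1
        have : ¬ inputs h i (Sum.inl ⟨j, hj⟩) = outer h i b hb := fun e => by
          have := hinj (a₁ := Sum.inl ⟨j, hj⟩) (a₂ := Sum.inl ⟨b, hb⟩) e
          simp at this
          exact hbj this.symm
        simp [hb, this]
      · simp [hj]
      · intro hmem
        obtain ⟨y, -, e⟩ := Multiset.mem_map.1 hmem
        have := hinj (a₁ := Sum.inr y) (a₂ := Sum.inl ⟨j, hj⟩) e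
        simp at this
    · rw [show inputs h i (Sum.inr j) = inner h i j from rfl,
        Multiset.count_map_eq_count' _ _ (fun a b e => by
          have := hinj (a₁ := Sum.inr a) (a₂ := Sum.inr b) e
          simpa using this), s.2]
      refine congrArg (1 + ·) (Finset.sum_eq_zero ?_)
      intro b hb
      have hb := (Finset.mem_erase.1 hb).1
      have : ¬ inner h i j = outer h i b hb := fun e => by
        have := hinj (a₁ := Sum.inr j) (a₂ := Sum.inl ⟨b, hb⟩) e
        simp at this
      simp [hb, this]⟩

end LTree

/-! ### The free operad on an `S_2`-module -/

section Free

variable {k : Type u} [Field k] {E : Type v} [AddCommGroup E] [Module k E]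

/-- The relations between decorated trees: linearity in the decoration of each vertex, and
equivariance at each vertex. -/
noncomputable def treeRelations (ρ : Representation k (Perm (Fin 2)) E) (n : ℕ) :
    Submodule k (LTree E n →₀ k) :=
  Submodule.span k
    ({x | ∃ (a b : k) (t t₁ t₂ : LTree E n), DTree.LinRel a b t.1 t₁.1 t₂.1 ∧
        x = Finsupp.single t 1 - (a • Finsupp.single t₁ 1 + b • Finsupp.single t₂ 1)} ∪
      {x | ∃ t t' : LTree E n, DTree.SwapRel ρ t.1 t'.1 ∧
        x = Finsupp.single t 1 - Finsupp.single t' 1})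

/-- `Free(E)(n)`: the vector space spanned by the labelled binary trees with vertices decorated by
`E` and with `n` leaves, modulo linearity and equivariance at each vertex. -/
abbrev FreeSpace (ρ : Representation k (Perm (Fin 2)) E) (n : ℕ) : Type (max u v) :=
  (LTree E n →₀ k) ⧸ treeRelations ρ n

/-- The element of `Free(E)(n)` given by a tree. -/
noncomputable def tree (ρ : Representation k (Perm (Fin 2)) E) {n : ℕ} (t : LTree E n) :
    FreeSpace ρ n :=
  Submodule.Quotient.mk (Finsupp.single t 1)

variable {ρ : Representation k (Perm (Fin 2)) E}

theorem tree_lin {a b : k} {n : ℕ} {t t₁ t₂ : LTree E n}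
    (h : DTree.LinRel a b t.1 t₁.1 t₂.1) : tree ρ t = a • tree ρ t₁ + b • tree ρ t₂ := by
  refine (Submodule.Quotient.eq (treeRelations ρ n)).2 (Submodule.subset_span (Or.inl ?_))
  exact ⟨a, b, t, t₁, t₂, h, rfl⟩

theorem tree_swap {n : ℕ} {t t' : LTree E n} (h : DTree.SwapRel ρ t.1 t'.1) :
    tree ρ t = tree ρ t' := by
  refine (Submodule.Quotient.eq (treeRelations ρ n)).2 (Submodule.subset_span (Or.inr ?_))
  exact ⟨t, t', h, rfl⟩

/-- Linear maps out of `Free(E)(n)` are given by functions on trees that respect the relations. -/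
noncomputable def freeLift {M : Type*} [AddCommGroup M] [Module k M] {n : ℕ} (f : LTree E n → M)
    (hlin : ∀ (a b : k) (t t₁ t₂ : LTree E n), DTree.LinRel a b t.1 t₁.1 t₂.1 →
      f t = a • f t₁ + b • f t₂)
    (hswap : ∀ t t' : LTree E n, DTree.SwapRel ρ t.1 t'.1 → f t = f t') :
    FreeSpace ρ n →ₗ[k] M :=
  (treeRelations ρ n).liftQ (Finsupp.linearCombination k f) (by
    rw [treeRelations, Submodule.span_le]
    rintro x (⟨a, b, t, t₁, t₂, h, rfl⟩ | ⟨t, t', h, rfl⟩)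
    · simp [hlin a b t t₁ t₂ h]
    · simp [hswap t t' h])

@[simp] theorem freeLift_tree {M : Type*} [AddCommGroup M] [Module k M] {n : ℕ}
    (f : LTree E n → M) (hlin : ∀ (a b : k) (t t₁ t₂ : LTree E n),
      DTree.LinRel a b t.1 t₁.1 t₂.1 → f t = a • f t₁ + b • f t₂)
    (hswap : ∀ t t' : LTree E n, DTree.SwapRel ρ t.1 t'.1 → f t = f t') (t : LTree E n) :
    freeLift (ρ := ρ) f hlin hswap (tree ρ t) = f t := by
  change Finsupp.linearCombination k f (Finsupp.single t 1) = f t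
  simp

theorem free_hom_ext {M : Type*} [AddCommGroup M] [Module k M] {n : ℕ}
    {f g : FreeSpace ρ n →ₗ[k] M} (h : ∀ t, f (tree ρ t) = g (tree ρ t)) : f = g := by
  apply Submodule.linearMap_qext
  apply Finsupp.lhom_ext'
  intro t
  ext
  exact h t

theorem free_induction {n : ℕ} {p : FreeSpace ρ n → Prop} (h : ∀ t, p (tree ρ t)) (h0 : p 0)
    (hadd : ∀ x y, p x → p y → p (x + y)) (hsmul : ∀ (c : k) x, p x → p (c • x))
    (x : FreeSpace ρ n) : p x := by
  obtain ⟨x, rfl⟩ := Submodule.Quotient.mk_surjective _ x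
  induction x using Finsupp.induction_linear with
  | zero => exact h0
  | add x y hx hy => exact hadd _ _ hx hy
  | single t c =>
    have := hsmul c _ (h t)
    rwa [tree, ← Submodule.Quotient.mk_smul, Finsupp.smul_single, smul_eq_mul, mul_one] at this

/-- The symmetric group acts on `Free(E)(n)` by permuting the labels of the leaves. -/
noncomputable def freeAct (ρ : Representation k (Perm (Fin 2)) E) (n : ℕ) :
    Representation k (Perm (Fin n)) (FreeSpace ρ n) where
  toFun σ := freeLift (fun t => tree ρ (t.perm σ))
    (fun _ _ _ _ _ h => tree_lin (h.subst _)) (fun _ _ h => tree_swap (h.subst _))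
  map_one' := by
    refine free_hom_ext fun t => ?_
    rw [freeLift_tree]
    exact congrArg _ (LTree.ext (DTree.subst_leaf _))
  map_mul' σ τ := by
    refine free_hom_ext fun t => ?_
    rw [Module.End.mul_apply, freeLift_tree, freeLift_tree, freeLift_tree]
    exact congrArg _ (LTree.ext (Eq.symm (DTree.subst_subst _ _ t.1)))

@[simp] theorem freeAct_tree {n : ℕ} (σ : Perm (Fin n)) (t : LTree E n) :
    freeAct ρ n σ (tree ρ t) = tree ρ (t.perm σ) := by
  simp only [freeAct, MonoidHom.coe_mk, OneHom.coe_mk, freeLift_tree]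

/-- The partial compositions of `Free(E)`, by grafting of trees. -/
noncomputable def freeCirc (ρ : Representation k (Perm (Fin 2)) E) {n m N : ℕ}
    (h : N + 1 = n + m) (i : Fin n) :
    FreeSpace ρ n →ₗ[k] FreeSpace ρ m →ₗ[k] FreeSpace ρ N :=
  freeLift
    (fun t => freeLift (fun s => tree ρ (LTree.circ h i t s))
      (fun _ _ s s₁ s₂ hs => tree_lin (DTree.LinRel.subst_right (i := i)
        (fun j hj => by rw [LTree.grafts_ne h i _ j hj, LTree.grafts_ne h i _ j hj])
        (fun j hj => by rw [LTree.grafts_ne h i _ j hj, LTree.grafts_ne h i _ j hj])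
        (by simp only [LTree.grafts_self]; exact hs.subst _) (t.2 i)))
      (fun s s' hs => tree_swap (DTree.SwapRel.subst_right (i := i)
        (fun j hj => by rw [LTree.grafts_ne h i _ j hj, LTree.grafts_ne h i _ j hj])
        (by simp only [LTree.grafts_self]; exact hs.subst _) (t.2 i))))
    (fun a b t t₁ t₂ ht => by
      refine free_hom_ext fun s => ?_
      simp only [LinearMap.add_apply, LinearMap.smul_apply, freeLift_tree]
      exact tree_lin (ht.subst _))
    (fun t t' ht => by
      refine free_hom_ext fun s => ?_
      simp only [freeLift_tree]
      exact tree_swap (ht.subst _))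

@[simp] theorem freeCirc_tree {n m N : ℕ} (h : N + 1 = n + m) (i : Fin n)
    (t : LTree E n) (s : LTree E m) :
    freeCirc ρ h i (tree ρ t) (tree ρ s) = tree ρ (LTree.circ h i t s) := by
  rw [freeCirc, freeLift_tree, freeLift_tree]

/-- The free operad `Free(E)` on an `S_2`-module `E`. -/
noncomputable def Free (ρ : Representation k (Perm (Fin 2)) E) : Operad.{u, max u v} k where
  obj n := FreeSpace ρ n
  subsingleton_zero := by
    have : IsEmpty (LTree E 0) := ⟨fun t => by
      obtain ⟨t, -⟩ := t
      induction t with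
      | leaf x => exact x.elim0
      | node e l r hl hr => exact hl⟩
    exact (Submodule.mkQ_surjective (treeRelations ρ 0)).subsingleton
  act n := freeAct ρ n
  one := tree ρ LTree.one
  circ h i := freeCirc ρ h i
  one_circ h μ := by
    induction μ using free_induction with
    | h0 => simp
    | hadd x y hx hy => simp [hx, hy]
    | hsmul c x hx => simp [hx]
    | h t =>
      rw [freeCirc_tree]
      refine congrArg _ (LTree.ext ?_)
      change LTree.grafts h 0 t.1 0 = t.1
      rw [LTree.grafts_self]
      conv_rhs => rw [← DTree.subst_leaf t.1]
      refine congrArg (fun f => DTree.subst f t.1) (funext fun j => congrArg _ (Fin.ext ?_))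
      simp [inner]
  circ_one h i ν := by
    induction ν using free_induction with
    | h0 => simp
    | hadd x y hx hy => simp [hx, hy]
    | hsmul c x hx => simp [hx]
    | h t =>
      rw [freeCirc_tree]
      refine congrArg _ (LTree.ext ?_)
      change DTree.subst (LTree.grafts h i (.leaf 0)) t.1 = t.1
      conv_rhs => rw [← DTree.subst_leaf t.1]
      refine congrArg (fun f => DTree.subst f t.1) (funext fun j => ?_)
      by_cases hj : j = i
      · subst hj
        rw [LTree.grafts_self]
        exact congrArg _ (Fin.ext (by simp [inner]))
      · rw [LTree.grafts_ne _ _ _ _ hj]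
        exact congrArg _ (Fin.ext (by simp [outer]))
  circ_assoc h₁ h h₂ h' i j ν μ κ := by
    induction ν using free_induction with
    | h0 => simp
    | hadd x y hx hy => simp [hx, hy]
    | hsmul c x hx => simp [hx]
    | h t =>
    induction μ using free_induction with
    | h0 => simp
    | hadd x y hx hy => simp [hx, hy]
    | hsmul c x hx => simp [hx]
    | h s =>
    induction κ using free_induction with
    | h0 => simp
    | hadd x y hx hy => simp only [map_add, hx, hy]
    | hsmul c x hx => simp only [map_smul, hx]
    | h r =>
      simp only [freeCirc_tree]
      refine congrArg _ (LTree.ext ?_)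
      change DTree.subst _ (DTree.subst _ t.1) = DTree.subst _ t.1
      rw [DTree.subst_subst]
      refine congrArg (fun f => DTree.subst f t.1) (funext fun a => ?_)
      by_cases ha : a = i
      · subst ha
        rw [LTree.grafts_self, LTree.grafts_self]
        change DTree.subst _ (DTree.subst _ s.1) = DTree.subst _ (DTree.subst _ s.1)
        rw [DTree.subst_subst, DTree.subst_subst]
        refine congrArg (fun f => DTree.subst f s.1) (funext fun b => ?_)
        by_cases hb : b = j
        · subst hb
          rw [LTree.grafts_self]
          simp only [DTree.subst]
          rw [LTree.grafts_self, DTree.relabel, DTree.relabel, DTree.subst_subst]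
          refine congrArg (fun f => DTree.subst f r.1) (funext fun c => congrArg _ (Fin.ext ?_))
          simp [inner, add_assoc]
        · rw [LTree.grafts_ne _ _ _ _ hb]
          simp only [DTree.subst]
          rw [LTree.grafts_ne _ _ _ _ (fun e => hb (by simpa [inner, Fin.ext_iff] using e))]
          refine congrArg _ (Fin.ext ?_)
          have := Fin.val_ne_of_ne hb
          by_cases hlt : (b : ℕ) < (j : ℕ)
          · simp [inner, outer, hlt]
          · simp [inner, outer, hlt]
            omega
      · rw [LTree.grafts_ne _ _ _ _ ha, LTree.grafts_ne _ _ _ _ ha]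
        simp only [DTree.subst]
        have ha' := Fin.val_ne_of_ne ha
        have := j.2
        have := a.2
        rw [LTree.grafts_ne _ _ _ _ (fun e => by
          have := congrArg Fin.val e
          simp only [inner, outer] at this
          split_ifs at this <;> omega)]
        refine congrArg _ (Fin.ext ?_)
        simp only [inner, outer]
        split_ifs <;> omega
  circ_comm h₁ h h₂ h' i j hij ν μ κ := by
    induction ν using free_induction with
    | h0 => simp
    | hadd x y hx hy => simp [hx, hy]
    | hsmul c x hx => simp [hx]
    | h t =>
    induction μ using free_induction with
    | h0 => simp
    | hadd x y hx hy => simp [hx, hy]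
    | hsmul c x hx => simp [hx]
    | h s =>
    induction κ using free_induction with
    | h0 => simp
    | hadd x y hx hy => simp only [map_add, LinearMap.add_apply, hx, hy]
    | hsmul c x hx => simp only [map_smul, LinearMap.smul_apply, hx]
    | h r =>
      simp only [freeCirc_tree]
      refine congrArg _ (LTree.ext ?_)
      change DTree.subst _ (DTree.subst _ t.1) = DTree.subst _ (DTree.subst _ t.1)
      rw [DTree.subst_subst, DTree.subst_subst]
      refine congrArg (fun f => DTree.subst f t.1) (funext fun a => ?_)
      have hij' := Fin.val_ne_of_ne hij
      have := i.2
      have := j.2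
      have := a.2
      by_cases ha : a = i
      · subst ha
        rw [LTree.grafts_self, LTree.grafts_ne _ _ _ _ hij]
        simp only [DTree.subst]
        rw [LTree.grafts_self, DTree.relabel, DTree.relabel, DTree.subst_subst]
        refine congrArg (fun f => DTree.subst f s.1) (funext fun c => ?_)
        simp only [DTree.subst]
        have := c.2
        rw [LTree.grafts_ne _ _ _ _ (fun e => by
          have := congrArg Fin.val e
          simp only [inner, outer] at this
          split_ifs at this <;> omega)]
        refine congrArg _ (Fin.ext ?_)
        simp only [inner, outer]
        split_ifs <;> omega
      · by_cases hb : a = j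
        · subst hb
          rw [LTree.grafts_self, LTree.grafts_ne _ _ _ _ hij.symm]
          simp only [DTree.subst]
          rw [LTree.grafts_self, DTree.relabel, DTree.relabel, DTree.subst_subst]
          refine congrArg (fun f => DTree.subst f r.1) (funext fun c => ?_)
          simp only [DTree.subst]
          have := c.2
          rw [LTree.grafts_ne _ _ _ _ (fun e => by
            have := congrArg Fin.val e
            simp only [inner, outer] at this
            split_ifs at this <;> omega)]
          refine congrArg _ (Fin.ext ?_)
          simp only [inner, outer]
          split_ifs <;> omega
        · rw [LTree.grafts_ne _ _ _ _ ha, LTree.grafts_ne _ _ _ _ hb]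
          simp only [DTree.subst]
          have := Fin.val_ne_of_ne ha
          have := Fin.val_ne_of_ne hb
          rw [LTree.grafts_ne _ _ _ _ (fun e => by
            have := congrArg Fin.val e
            simp only [outer] at this
            split_ifs at this <;> omega), LTree.grafts_ne _ _ _ _ (fun e => by
            have := congrArg Fin.val e
            simp only [outer] at this
            split_ifs at this <;> omega)]
          refine congrArg _ (Fin.ext ?_)
          simp only [outer]
          split_ifs <;> omega
  act_circ h i σ τ ν μ := by
    induction ν using free_induction with
    | h0 => simp
    | hadd x y hx hy => simp [hx, hy]
    | hsmul c x hx => simp [hx]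
    | h t =>
    induction μ using free_induction with
    | h0 => simp
    | hadd x y hx hy => simp only [map_add, hx, hy]
    | hsmul c x hx => simp only [map_smul, hx]
    | h s =>
      simp only [freeCirc_tree, freeAct_tree]
      refine congrArg _ (LTree.ext ?_)
      change DTree.subst _ (DTree.subst _ t.1) = DTree.subst _ (DTree.subst _ t.1)
      rw [DTree.subst_subst, DTree.subst_subst]
      refine congrArg (fun f => DTree.subst f t.1) (funext fun a => ?_)
      by_cases ha : a = i
      · subst ha
        simp only [DTree.subst]
        rw [LTree.grafts_self, LTree.grafts_self]
        change DTree.subst _ (DTree.subst _ s.1) = DTree.subst _ (DTree.subst _ s.1)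
        rw [DTree.subst_subst, DTree.subst_subst]
        refine congrArg (fun f => DTree.subst f s.1) (funext fun b => ?_)
        simp only [DTree.subst, blockPerm_inner]
      · simp only [DTree.subst]
        rw [LTree.grafts_ne _ _ _ _ ha, LTree.grafts_ne _ _ _ _ (fun e => ha (σ.injective e))]
        simp only [DTree.subst, blockPerm_outer]

end Free

/-! ### Quadratic operads and their duals -/

/-- The tensor product of a representation of the symmetric group with the sign
representation. -/
def signTwist {k : Type u} [Field k] {V : Type v} [AddCommGroup V] [Module k V] {n : ℕ}
    (ρ : Representation k (Perm (Fin n)) V) : Representation k (Perm (Fin n)) V where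
  toFun σ := ((Perm.sign σ : ℤ) : k) • ρ σ
  map_one' := by simp
  map_mul' σ τ := by
    ext
    simp [smul_smul, mul_comm]

/-- The dual `V^∨ = V^* ⊗ sgn` of an `S_n`-module: the dual space with the action
`σ • α = sgn(σ) (α ∘ σ⁻¹)`. -/
def czechDual {k : Type u} [Field k] {V : Type v} [AddCommGroup V] [Module k V] {n : ℕ}
    (ρ : Representation k (Perm (Fin n)) V) :
    Representation k (Perm (Fin n)) (Module.Dual k V) :=
  signTwist ρ.dual

theorem czechDual_apply {k : Type u} [Field k] {V : Type v} [AddCommGroup V] [Module k V] {n : ℕ}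
    (ρ : Representation k (Perm (Fin n)) V) (σ : Perm (Fin n)) (α : Module.Dual k V) (v : V) :
    czechDual ρ σ α v = ((Perm.sign σ : ℤ) : k) * α (ρ σ⁻¹ v) := by
  rw [czechDual, signTwist, MonoidHom.coe_mk, OneHom.coe_mk, LinearMap.smul_apply,
    Representation.dual_apply]
  rfl

section Combs

variable {E : Type v}

/-- The tree `e (f (σ(1), σ(2)), σ(3))` (with labels counted from `0` in the code). -/
def leftCombTree (e f : E) (σ : Perm (Fin 3)) : LTree E 3 :=
  ⟨.node e (.node f (.leaf (σ 0)) (.leaf (σ 1))) (.leaf (σ 2)), fun x => by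
    obtain ⟨y, rfl⟩ := σ.surjective x
    fin_cases y <;> simp [DTree.leaves]⟩

/-- The tree `e (σ(1), f (σ(2), σ(3)))`. -/
def rightCombTree (e f : E) (σ : Perm (Fin 3)) : LTree E 3 :=
  ⟨.node e (.leaf (σ 0)) (.node f (.leaf (σ 1)) (.leaf (σ 2))), fun x => by
    obtain ⟨y, rfl⟩ := σ.surjective x
    fin_cases y <;> simp [DTree.leaves]⟩

variable {k : Type u} [Field k] [AddCommGroup E] [Module k E]

/-- The element `e (f (σ(1), σ(2)), σ(3))` of `Free(E)(3)`. -/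
noncomputable def leftComb (ρ : Representation k (Perm (Fin 2)) E) (e f : E) (σ : Perm (Fin 3)) :
    FreeSpace ρ 3 :=
  tree ρ (leftCombTree e f σ)

/-- The element `e (σ(1), f (σ(2), σ(3)))` of `Free(E)(3)`. -/
noncomputable def rightComb (ρ : Representation k (Perm (Fin 2)) E) (e f : E) (σ : Perm (Fin 3)) :
    FreeSpace ρ 3 :=
  tree ρ (rightCombTree e f σ)

end Combs

/-- The sign of the permutation `1 ↦ a, 2 ↦ b, 3 ↦ c` (and `0` if this is not a permutation). -/
def sgn3 (a b c : Fin 3) : ℤ :=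
  Int.sign (((b : ℤ) - a) * ((c : ℤ) - a) * ((c : ℤ) - b))

theorem sgn3_perm (σ : Perm (Fin 3)) : sgn3 (σ 0) (σ 1) (σ 2) = Perm.sign σ := by
  revert σ
  decide

theorem sgn3_comp (σ : Perm (Fin 3)) (a b c : Fin 3) :
    sgn3 (σ a) (σ b) (σ c) = Perm.sign σ * sgn3 a b c := by
  revert σ a b c
  decide

theorem sgn3_swap (a b c : Fin 3) : sgn3 b a c = -sgn3 a b c := by
  revert a b c
  decide

theorem sgn3_swap' (a b c : Fin 3) : sgn3 a c b = -sgn3 a b c := by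
  revert a b c
  decide

theorem sgn3_rotate (a b c : Fin 3) : sgn3 b c a = sgn3 a b c := by
  revert a b c
  decide

namespace DTree

/-- The sign of a tree with three leaves: `sgn(σ)` for `α (β (σ(1), σ(2)), σ(3))` and `-sgn(σ)`
for `α (σ(1), β (σ(2), σ(3)))`. -/
def combSign {E : Type v} : DTree E (Fin 3) → ℤ
  | .node _ (.node _ (.leaf a) (.leaf b)) (.leaf c) => sgn3 a b c
  | .node _ (.leaf a) (.node _ (.leaf b) (.leaf c)) => -sgn3 a b c
  | _ => 0

section

variable {k : Type u} [Field k] {E : Type v} [AddCommGroup E] [Module k E] {X : Type w}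
  [DecidableEq X]

/-- The pairing (without signs) between trees decorated by `E^*` and trees decorated by `E`:
decorations at corresponding vertices are evaluated on each other, and trees of different shape, or
with different labels, have pairing `0`.  Trees are compared up to equivariance, that is, up to
interchanging the two inputs of a vertex with decoration `μ` while replacing `μ` by `(12) μ`. For
trees whose labels are all different, at most one of the two summands is nonzero. -/
def pair (ρ : Representation k (Perm (Fin 2)) E) :
    DTree (Module.Dual k E) X → DTree E X → k
  | .leaf a, .leaf b => if a = b then 1 else 0
  | .node α l r, .node μ l' r' =>
      α μ * (pair ρ l l' * pair ρ r r') +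
        α (ρ (Equiv.swap 0 1) μ) * (pair ρ l r' * pair ρ r l')
  | .leaf _, .node _ _ _ => 0
  | .node _ _ _, .leaf _ => 0

variable {ρ : Representation k (Perm (Fin 2)) E} {a b : k}

theorem pair_lin_left {t t₁ t₂ : DTree (Module.Dual k E) X} (h : LinRel a b t t₁ t₂)
    (s : DTree E X) : pair ρ t s = a * pair ρ t₁ s + b * pair ρ t₂ s := by
  induction h generalizing s with
  | root e₁ e₂ l r =>
    cases s <;> simp [pair]
    ring
  | left e r _ ih =>
    cases s <;> simp [pair, ih]
    ring
  | right e r _ ih =>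
    cases s <;> simp [pair, ih]
    ring

theorem pair_lin_right {s s₁ s₂ : DTree E X} (h : LinRel a b s s₁ s₂)
    (t : DTree (Module.Dual k E) X) : pair ρ t s = a * pair ρ t s₁ + b * pair ρ t s₂ := by
  induction h generalizing t with
  | root e₁ e₂ l r =>
    cases t <;> simp [pair]
    ring
  | left e r _ ih =>
    cases t <;> simp [pair, ih]
    ring
  | right e r _ ih =>
    cases t <;> simp [pair, ih]
    ring

theorem swap_swap_apply (ρ : Representation k (Perm (Fin 2)) E) (e : E) :
    ρ (Equiv.swap 0 1) (ρ (Equiv.swap 0 1) e) = e := by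
  rw [← Module.End.mul_apply, ← map_mul, Equiv.swap_mul_self, map_one, Module.End.one_apply]

theorem pair_swap_left {t t' : DTree (Module.Dual k E) X} (h : SwapRel (czechDual ρ) t t')
    (s : DTree E X) : pair ρ t s = -pair ρ t' s := by
  induction h generalizing s with
  | root e l r =>
    cases s <;> simp [pair, czechDual_apply, swap_swap_apply]
    ring
  | left e r _ ih =>
    cases s <;> simp [pair, ih]
    ring
  | right e r _ ih =>
    cases s <;> simp [pair, ih]
    ring

theorem pair_swap_right {s s' : DTree E X} (h : SwapRel ρ s s')
    (t : DTree (Module.Dual k E) X) : pair ρ t s = pair ρ t s' := by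
  induction h generalizing t with
  | root e l r =>
    cases t <;> simp [pair, swap_swap_apply]
    ring
  | left e r _ ih => cases t <;> simp [pair, ih]
  | right e r _ ih => cases t <;> simp [pair, ih]

theorem pair_relabel {Y : Type*} [DecidableEq Y] {f : X → Y} (hf : Function.Injective f)
    (t : DTree (Module.Dual k E) X) (s : DTree E X) :
    pair ρ (t.relabel f) (s.relabel f) = pair ρ t s := by
  induction t generalizing s with
  | leaf x => cases s <;> simp [relabel, subst, pair, hf.eq_iff]
  | node e l r hl hr =>
    simp only [relabel] at hl hr
    cases s <;> simp [relabel, subst, pair, hl, hr]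

end

section

variable {k : Type u} [Field k] {E : Type v} [AddCommGroup E] [Module k E] {a b : k}

theorem combSign_lin {t t₁ t₂ : DTree E (Fin 3)} (h : LinRel a b t t₁ t₂) :
    combSign t = combSign t₁ ∧ combSign t = combSign t₂ := by
  rcases h with ⟨e₁, e₂, l, r⟩ | ⟨e, r, h⟩ | ⟨e, l, h⟩
  · rcases l with _ | ⟨_, _ | _, _ | _⟩ <;> rcases r with _ | ⟨_, _ | _, _ | _⟩ <;>
      exact ⟨rfl, rfl⟩
  · rcases h with ⟨e₁, e₂, l, r'⟩ | ⟨e, r', h⟩ | ⟨e, l, h⟩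
    · rcases l with _ | _ <;> rcases r' with _ | _ <;> rcases r with _ | _ <;> exact ⟨rfl, rfl⟩
    · rcases h with _ | _ | _ <;> rcases r with _ | _ <;> exact ⟨rfl, rfl⟩
    · rcases h with _ | _ | _ <;> rcases l with _ | _ <;> rcases r with _ | _ <;> exact ⟨rfl, rfl⟩
  · rcases h with ⟨e₁, e₂, l', r⟩ | ⟨e, r, h⟩ | ⟨e, l', h⟩
    · rcases l' with _ | _ <;> rcases r with _ | _ <;> rcases l with _ | ⟨_, _ | _, _ | _⟩ <;>
        exact ⟨rfl, rfl⟩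
    · rcases h with _ | _ | _ <;> rcases l with _ | ⟨_, _ | _, _ | _⟩ <;> exact ⟨rfl, rfl⟩
    · rcases h with _ | _ | _ <;> rcases l' with _ | _ <;>
        rcases l with _ | ⟨_, _ | _, _ | _⟩ <;> exact ⟨rfl, rfl⟩

theorem combSign_swap {ρ : Representation k (Perm (Fin 2)) E} {t t' : DTree E (Fin 3)}
    (h : SwapRel ρ t t') : combSign t = -combSign t' := by
  rcases h with ⟨e, l, r⟩ | ⟨e, r, h⟩ | ⟨e, l, h⟩
  · rcases l with _ | ⟨_, _ | _, _ | _⟩ <;> rcases r with _ | ⟨_, _ | _, _ | _⟩ <;>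
      simp [combSign, sgn3_rotate]
  · rcases h with ⟨e, l, r'⟩ | ⟨e, r', h⟩ | ⟨e, l, h⟩
    · rcases l with a | _ <;> rcases r' with b | _ <;> rcases r with _ | _ <;>
        first | rfl | simp [combSign, sgn3_swap a b]
    · rcases h with _ | _ | _ <;> rcases r with _ | _ <;> rfl
    · rcases h with _ | _ | _ <;> rcases l with _ | _ <;> rcases r with _ | _ <;> rfl
  · rcases h with ⟨e, l', r⟩ | ⟨e, r, h⟩ | ⟨e, l', h⟩
    · rcases l' with a | _ <;> rcases r with b | _ <;> rcases l with c | ⟨_, _ | _, _ | _⟩ <;>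
        first | rfl | simp [combSign, sgn3_swap' c a b]
    · rcases h with _ | _ | _ <;> rcases l with _ | ⟨_, _ | _, _ | _⟩ <;> rfl
    · rcases h with _ | _ | _ <;> rcases l' with _ | _ <;>
        rcases l with _ | ⟨_, _ | _, _ | _⟩ <;> rfl

theorem combSign_relabel {E : Type v} (σ : Perm (Fin 3)) (t : DTree E (Fin 3)) :
    combSign (t.relabel σ) = Perm.sign σ * combSign t := by
  rcases t with _ | ⟨_, _ | ⟨_, _ | _, _ | _⟩, _ | ⟨_, _ | _, _ | _⟩⟩ <;>
    simp [relabel, subst, combSign, sgn3_comp]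

end

end DTree

section Pairing

variable {k : Type u} [Field k] {E : Type v} [AddCommGroup E] [Module k E]
  {ρ : Representation k (Perm (Fin 2)) E}

/-- The identification of `Free(E^∨)(3)` with the dual of `Free(E)(3)`, as a bilinear pairing: a
tree decorated by `E^∨` and a tree decorated by `E` have their pairing as trees, with the sign
`sgn(σ)` if the former is `α (β (σ(1), σ(2)), σ(3))`, and `-sgn(σ)` if it is
`α (σ(1), β (σ(2), σ(3)))`. -/
noncomputable def pairing (ρ : Representation k (Perm (Fin 2)) E) :
    FreeSpace (czechDual ρ) 3 →ₗ[k] FreeSpace ρ 3 →ₗ[k] k :=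
  freeLift
    (fun t => freeLift (fun s => (DTree.combSign t.1 : k) * DTree.pair ρ t.1 s.1)
      (fun a b s s₁ s₂ hs => by
        rw [DTree.pair_lin_right hs, smul_eq_mul, smul_eq_mul]
        ring)
      (fun s s' hs => by rw [DTree.pair_swap_right hs]))
    (fun a b t t₁ t₂ ht => by
      refine free_hom_ext fun s => ?_
      simp only [LinearMap.add_apply, LinearMap.smul_apply, freeLift_tree, smul_eq_mul]
      rw [DTree.pair_lin_left ht, ← (DTree.combSign_lin ht).1, ← (DTree.combSign_lin ht).2]
      ring)
    (fun t t' ht => by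
      refine free_hom_ext fun s => ?_
      simp only [freeLift_tree]
      rw [DTree.pair_swap_left ht, DTree.combSign_swap ht]
      push_cast
      ring)

theorem pairing_tree (ρ : Representation k (Perm (Fin 2)) E) (t : LTree (Module.Dual k E) 3)
    (s : LTree E 3) :
    pairing ρ (tree (czechDual ρ) t) (tree ρ s) =
      (DTree.combSign t.1 : k) * DTree.pair ρ t.1 s.1 := by
  rw [pairing, freeLift_tree, freeLift_tree]

theorem pairing_leftComb (ρ : Representation k (Perm (Fin 2)) E) (α β : Module.Dual k E)
    (μ ν : E) (σ : Perm (Fin 3)) :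
    pairing ρ (leftComb (czechDual ρ) α β σ) (leftComb ρ μ ν σ) =
      ((Perm.sign σ : ℤ) : k) * (α μ * β ν) := by
  rw [leftComb, leftComb, pairing_tree]
  simp [leftCombTree, DTree.combSign, DTree.pair, sgn3_perm]

theorem pairing_rightComb (ρ : Representation k (Perm (Fin 2)) E) (α β : Module.Dual k E)
    (μ ν : E) (σ : Perm (Fin 3)) :
    pairing ρ (rightComb (czechDual ρ) α β σ) (rightComb ρ μ ν σ) =
      -((Perm.sign σ : ℤ) : k) * (α μ * β ν) := by
  rw [rightComb, rightComb, pairing_tree]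
  simp [rightCombTree, DTree.combSign, DTree.pair, sgn3_perm]

/-- The pairing identifies `Free(E^∨)(3)` with `Free(E)(3)^∨` compatibly with the actions
of `S_3`. -/
theorem pairing_act (ρ : Representation k (Perm (Fin 2)) E) (σ : Perm (Fin 3))
    (x : FreeSpace (czechDual ρ) 3) (y : FreeSpace ρ 3) :
    pairing ρ (freeAct (czechDual ρ) 3 σ x) (freeAct ρ 3 σ y) =
      ((Perm.sign σ : ℤ) : k) * pairing ρ x y := by
  induction x using free_induction with
  | h0 => simp
  | hadd x x' hx hx' => simp only [map_add, LinearMap.add_apply, hx, hx', mul_add]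
  | hsmul c x hx => simp only [map_smul, LinearMap.smul_apply, hx, smul_eq_mul, mul_left_comm]
  | h t =>
  induction y using free_induction with
  | h0 => simp
  | hadd x x' hx hx' => simp only [map_add, hx, hx', mul_add]
  | hsmul c x hx => simp only [map_smul, hx, smul_eq_mul, mul_left_comm]
  | h s =>
    rw [freeAct_tree, freeAct_tree, pairing_tree, pairing_tree]
    change (DTree.combSign (t.1.relabel σ) : k) * DTree.pair ρ (t.1.relabel σ) (s.1.relabel σ) = _
    rw [DTree.combSign_relabel, DTree.pair_relabel σ.injective]
    push_cast
    ring

/-- The annihilator `Ann(R)` in `Free(E^∨)(3)` of a subspace `R` of `Free(E)(3)`. -/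
noncomputable def ann (ρ : Representation k (Perm (Fin 2)) E) (R : Submodule k (FreeSpace ρ 3)) :
    Submodule k (FreeSpace (czechDual ρ) 3) :=
  R.dualAnnihilator.comap (pairing ρ)

theorem mem_ann {R : Submodule k (FreeSpace ρ 3)} {x : FreeSpace (czechDual ρ) 3} :
    x ∈ ann ρ R ↔ ∀ y ∈ R, pairing ρ x y = 0 := by
  rw [ann, Submodule.mem_comap, Submodule.mem_dualAnnihilator]

/-- The `S_3`-submodule of `Free(E)(3)` generated by `S`: the relations `r ∈ S` in all
labellings. -/
noncomputable def relSpan (ρ : Representation k (Perm (Fin 2)) E) (S : Set (FreeSpace ρ 3)) :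
    Submodule k (FreeSpace ρ 3) :=
  Submodule.span k {x | ∃ (σ : Perm (Fin 3)) (r : FreeSpace ρ 3), r ∈ S ∧ x = freeAct ρ 3 σ r}

end Pairing

/-- A quadratic presentation `(E, R)`: a finite-dimensional `S_2`-module `E` of binary generators
and an `S_3`-submodule `R` of relations in `Free(E)(3)`. -/
structure QuadraticData (k : Type u) [Field k] where
  E : Type u
  [addCommGroup : AddCommGroup E]
  [module : Module k E]
  [finiteDimensional : FiniteDimensional k E]
  ρ : Representation k (Perm (Fin 2)) E
  R : Submodule k (FreeSpace ρ 3)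
  act_mem : ∀ (σ : Perm (Fin 3)) (x : FreeSpace ρ 3), x ∈ R → freeAct ρ 3 σ x ∈ R

attribute [instance] QuadraticData.addCommGroup QuadraticData.module
  QuadraticData.finiteDimensional

/-- The quadratic operad `Q(E, R) = Free(E) / ⟨R⟩`. -/
noncomputable def QuadraticData.operad {k : Type u} [Field k] (D : QuadraticData k) :
    Operad.{u, u} k :=
  (Free D.ρ).quotient (Operad.Ideal.generatedBy (Free D.ρ) (r := 3) (D.R : Set (FreeSpace D.ρ 3)))

/-- The presentation `(E^∨, Ann(R))` of the quadratic dual `Q(E, R)^! = Q(E^∨, Ann(R))`. -/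
noncomputable def QuadraticData.dual {k : Type u} [Field k] (D : QuadraticData k) :
    QuadraticData k where
  E := Module.Dual k D.E
  ρ := czechDual D.ρ
  R := ann D.ρ D.R
  act_mem σ x hx := by
    rw [mem_ann] at hx ⊢
    intro y hy
    have h := pairing_act D.ρ σ x (freeAct D.ρ 3 σ⁻¹ y)
    rw [hx _ (D.act_mem _ _ hy), mul_zero] at h
    rwa [Representation.self_inv_apply] at h

/-- The presentation with generators `E`, and with the relations `r ∈ S` in all labellings. -/
noncomputable def QuadraticData.ofRelations {k : Type u} [Field k] {E : Type u} [AddCommGroup E]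
    [Module k E] [FiniteDimensional k E] (ρ : Representation k (Perm (Fin 2)) E)
    (S : Set (FreeSpace ρ 3)) : QuadraticData k where
  E := E
  ρ := ρ
  R := relSpan ρ S
  act_mem σ x hx := by
    induction hx using Submodule.span_induction with
    | mem x hx =>
      obtain ⟨τ, r, hr, rfl⟩ := hx
      refine Submodule.subset_span ⟨σ * τ, r, hr, ?_⟩
      rw [map_mul, Module.End.mul_apply]
    | zero => simp
    | add x y _ _ hx hy => rw [map_add]; exact add_mem hx hy
    | smul c x _ hx => rw [map_smul]; exact Submodule.smul_mem _ c hx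

/-! ### The four operads -/

section Examples

variable (k : Type u) [Field k]

/-- The `S_2`-module with basis `e_0, e_1`, interchanged by `(12)`. -/
def assRep : Representation k (Perm (Fin 2)) (Fin 2 → k) where
  toFun σ := LinearMap.funLeft k k (σ⁻¹ : Perm (Fin 2))
  map_one' := rfl
  map_mul' _ _ := rfl

theorem assRep_single (σ : Perm (Fin 2)) (i : Fin 2) :
    assRep k σ (Pi.single i 1) = Pi.single (σ i) 1 := by
  funext j
  have h : (σ⁻¹ : Perm (Fin 2)) j = i ↔ j = σ i := by rw [Perm.inv_eq_iff_eq]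
  change (Pi.single i 1 : Fin 2 → k) ((σ⁻¹ : Perm (Fin 2)) j) = _
  simp only [Pi.single_apply, h]

/-- The associativity relation `(x₁ x₂) x₃ - x₁ (x₂ x₃)` for a generator `e`. -/
noncomputable def assocRel {k : Type u} [Field k] {E : Type v} [AddCommGroup E] [Module k E]
    (ρ : Representation k (Perm (Fin 2)) E) (e : E) : FreeSpace ρ 3 :=
  leftComb ρ e e 1 - rightComb ρ e e 1

/-- The Jacobi relation `[x₁, [x₂, x₃]] + [x₂, [x₃, x₁]] + [x₃, [x₁, x₂]]` for a generator `e`. -/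
noncomputable def jacobiRel {k : Type u} [Field k] {E : Type v} [AddCommGroup E] [Module k E]
    (ρ : Representation k (Perm (Fin 2)) E) (e : E) : FreeSpace ρ 3 :=
  rightComb ρ e e 1 + rightComb ρ e e (finRotate 3) + rightComb ρ e e (finRotate 3 ^ 2)

/-- The distributivity relation `[x₁, x₂ x₃] - x₂ [x₁, x₃] - [x₁, x₂] x₃` for a commutative
generator `c` and a Lie generator `e`. -/
noncomputable def distribRel {k : Type u} [Field k] {E : Type v} [AddCommGroup E] [Module k E]
    (ρ : Representation k (Perm (Fin 2)) E) (c e : E) : FreeSpace ρ 3 :=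
  rightComb ρ e c 1 - rightComb ρ c e (Equiv.swap 0 1) - leftComb ρ c e 1

/-- The associative operad: two generators interchanged by `(12)`, and associativity. -/
noncomputable def Ass : QuadraticData k :=
  .ofRelations (assRep k) {assocRel (assRep k) (Pi.single 0 1)}

/-- The commutative operad: one generator, invariant under `(12)`, and associativity. -/
noncomputable def Com : QuadraticData k :=
  .ofRelations (Representation.trivial k (Perm (Fin 2)) k)
    {assocRel (Representation.trivial k (Perm (Fin 2)) k) 1}

/-- The Lie operad: one generator, of which `(12)` changes the sign, and the Jacobi identity. -/
noncomputable def Lie : QuadraticData k :=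
  .ofRelations (signTwist (Representation.trivial k (Perm (Fin 2)) k))
    {jacobiRel (signTwist (Representation.trivial k (Perm (Fin 2)) k)) 1}

/-- The `S_2`-module with basis `(1, 0), (0, 1)`, on which `(12)` acts as `1` and as `-1`. -/
noncomputable def poissRep : Representation k (Perm (Fin 2)) (k × k) :=
  (Representation.trivial k (Perm (Fin 2)) k).prod
    (signTwist (Representation.trivial k (Perm (Fin 2)) k))

/-- The Poisson operad: a commutative associative generator `(1, 0)` and a Lie generator `(0, 1)`,
and the distributivity relation between them. -/
noncomputable def Poiss : QuadraticData k :=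
  .ofRelations (poissRep k)
    {assocRel (poissRep k) (1, 0), jacobiRel (poissRep k) (0, 1),
      distribRel (poissRep k) (1, 0) (0, 1)}

end Examples

end QuadOperad

/-! The operad `Q(E, R)` depends functorially on the pair `(E, R)`: an isomorphism of `S_2`-modules
from `F` to `E^∨` that carries the relations `S` onto `Ann(R)` induces an isomorphism between `Q(F,
S)` and the quadratic dual of `Q(E, R)` (`QuadraticData.isoOfEquiv`,
`QuadraticData.nonempty_iso_dual`). Each of the four claims thus becomes linear algebra in arity 3.

On generators, the sign twist in `E^∨` exchanges the trivial and the sign representation. So the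
dual of the commutative generator is a Lie generator and conversely; for `Poiss` the two generators
change places, and for `Ass` the regular representation is self-dual after changing the sign of one
basis vector.

In arity 3, equivariance turns every tree into a left comb `e (f (σ(1), σ(2)), σ(3))`. If `E` is
spanned by eigenvectors of `(12)`, three cyclic relabellings per pair of decorations suffice. These
permutations are even, so the pairing of such combs carries no sign (`pairing_rotComb`).
Associativity of `c` then equates the three cyclic combs, Jacobi puts their sum equal to zero, and
these two conditions annihilate each other. For `Poiss`, the distributivity relations are also
orthogonal to their own dual copies.

Orthogonality gives one inclusion of the proposed relations `T` into `Ann(R)`. The reverse inclusion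
is a dimension count carried out without computing dimensions (`eq_ann_of_sup_eq_top`): elements `v
i` that span `Free(E^∨)(3)` together with `T`, and elements `r i` of `R` with `⟨v i, r j⟩ = 0`
exactly when `i ≠ j`. Neither linear independence of the combs nor nondegeneracy of the pairing is
needed. -/

namespace QuadOperad

open Equiv

universe u v w

/-! ### Functoriality of the free operad -/

namespace DTree

variable {E : Type v} {F : Type*} {X : Type w}

/-- Change the decorations of the vertices. -/
def mapDec (φ : E → F) : DTree E X → DTree F X
  | leaf x => leaf x
  | node e l r => node (φ e) (mapDec φ l) (mapDec φ r)

theorem leaves_mapDec (φ : E → F) (t : DTree E X) : (t.mapDec φ).leaves = t.leaves := by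
  induction t with
  | leaf x => rfl
  | node e l r hl hr => simp [mapDec, leaves, hl, hr]

theorem mapDec_subst {Y : Type*} (φ : E → F) (f : X → DTree E Y) (t : DTree E X) :
    (t.subst f).mapDec φ = (t.mapDec φ).subst fun x => (f x).mapDec φ := by
  induction t with
  | leaf x => rfl
  | node e l r hl hr => simp [mapDec, subst, hl, hr]

theorem mapDec_relabel {Y : Type*} (φ : E → F) (f : X → Y) (t : DTree E X) :
    (t.relabel f).mapDec φ = (t.mapDec φ).relabel f :=
  mapDec_subst φ _ t

theorem mapDec_mapDec {G : Type*} (φ : E → F) (ψ : F → G) (t : DTree E X) :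
    (t.mapDec φ).mapDec ψ = t.mapDec (ψ ∘ φ) := by
  induction t with
  | leaf x => rfl
  | node e l r hl hr => simp [mapDec, hl, hr]

theorem mapDec_id (t : DTree E X) : t.mapDec id = t := by
  induction t with
  | leaf x => rfl
  | node e l r hl hr => simp [mapDec, hl, hr]

variable {k : Type u} [Field k] [AddCommGroup E] [Module k E] [AddCommGroup F] [Module k F]

theorem LinRel.mapDec (φ : E →ₗ[k] F) {a b : k} {t t₁ t₂ : DTree E X} (h : LinRel a b t t₁ t₂) :
    LinRel a b (t.mapDec φ) (t₁.mapDec φ) (t₂.mapDec φ) := by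
  induction h with
  | root e₁ e₂ l r =>
    simp only [DTree.mapDec, map_add, map_smul]
    exact .root ..
  | left e r _ ih => exact .left _ _ ih
  | right e l _ ih => exact .right _ _ ih

theorem SwapRel.mapDec {ρ : Representation k (Perm (Fin 2)) E}
    {ρ' : Representation k (Perm (Fin 2)) F} (φ : E →ₗ[k] F)
    (hφ : ∀ e, φ (ρ (swap 0 1) e) = ρ' (swap 0 1) (φ e)) {t t' : DTree E X}
    (h : SwapRel ρ t t') : SwapRel ρ' (t.mapDec φ) (t'.mapDec φ) := by
  induction h with
  | root e l r =>
    simp only [DTree.mapDec, hφ]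
    exact .root ..
  | left e r _ ih => exact .left _ _ ih
  | right e l _ ih => exact .right _ _ ih

end DTree

/-- Change the decorations of the vertices of a labelled tree. -/
def LTree.mapDec {E : Type v} {F : Type w} (φ : E → F) {n : ℕ} (t : LTree E n) : LTree F n :=
  ⟨t.1.mapDec φ, fun x => by rw [DTree.leaves_mapDec, t.2]⟩

section FreeMap

variable {k : Type u} [Field k] {E : Type v} [AddCommGroup E] [Module k E]
  {F : Type w} [AddCommGroup F] [Module k F]
  {ρ : Representation k (Perm (Fin 2)) E} {ρ' : Representation k (Perm (Fin 2)) F}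

/-- The map `Free(E)(n) → Free(F)(n)` induced by an `S_2`-equivariant map `E → F`. -/
noncomputable def freeMap (φ : E →ₗ[k] F) (hφ : ∀ e, φ (ρ (swap 0 1) e) = ρ' (swap 0 1) (φ e))
    (n : ℕ) : FreeSpace ρ n →ₗ[k] FreeSpace ρ' n :=
  freeLift (fun t => tree ρ' (t.mapDec φ)) (fun _ _ _ _ _ h => tree_lin (h.mapDec φ))
    (fun _ _ h => tree_swap (h.mapDec φ hφ))

variable (φ : E →ₗ[k] F) (hφ : ∀ e, φ (ρ (swap 0 1) e) = ρ' (swap 0 1) (φ e))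

@[simp] theorem freeMap_tree {n : ℕ} (t : LTree E n) :
    freeMap φ hφ n (tree ρ t) = tree ρ' (t.mapDec φ) := by
  rw [freeMap, freeLift_tree]

theorem freeMap_act {n : ℕ} (σ : Perm (Fin n)) (x : FreeSpace ρ n) :
    freeMap φ hφ n (freeAct ρ n σ x) = freeAct ρ' n σ (freeMap φ hφ n x) := by
  induction x using free_induction with
  | h0 => simp
  | hadd x y hx hy => simp only [map_add, hx, hy]
  | hsmul c x hx => simp only [map_smul, hx]
  | h t =>
    simp only [freeAct_tree, freeMap_tree]
    exact congrArg _ (LTree.ext (DTree.mapDec_relabel _ _ t.1))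

theorem freeMap_circ {n m N : ℕ} (h : N + 1 = n + m) (i : Fin n) (x : FreeSpace ρ n)
    (y : FreeSpace ρ m) :
    freeMap φ hφ N (freeCirc ρ h i x y) =
      freeCirc ρ' h i (freeMap φ hφ n x) (freeMap φ hφ m y) := by
  induction x using free_induction with
  | h0 => simp
  | hadd x y hx hy => simp only [map_add, LinearMap.add_apply, hx, hy]
  | hsmul c x hx => simp only [map_smul, LinearMap.smul_apply, hx]
  | h t =>
  induction y using free_induction with
  | h0 => simp
  | hadd x y hx hy => simp only [map_add, hx, hy]
  | hsmul c x hx => simp only [map_smul, hx]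
  | h s =>
    simp only [freeCirc_tree, freeMap_tree]
    refine congrArg _ (LTree.ext ((DTree.mapDec_subst _ _ t.1).trans ?_))
    refine congrArg (fun f => DTree.subst f (t.1.mapDec φ)) (funext fun j => ?_)
    by_cases hj : j = i
    · subst hj
      rw [LTree.grafts_self, LTree.grafts_self]
      exact DTree.mapDec_relabel _ _ s.1
    · rw [LTree.grafts_ne _ _ _ _ hj, LTree.grafts_ne _ _ _ _ hj]
      rfl

/-- The homomorphism `Free(E) → Free(F)` induced by an `S_2`-equivariant map `E → F`. -/
noncomputable def freeHom : Operad.Hom (Free ρ) (Free ρ') where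
  toFun := freeMap φ hφ
  map_one := freeMap_tree φ hφ LTree.one
  map_circ := freeMap_circ φ hφ
  map_act _ := freeMap_act φ hφ

theorem freeMap_leftComb (e f : E) (σ : Perm (Fin 3)) :
    freeMap φ hφ 3 (leftComb ρ e f σ) = leftComb ρ' (φ e) (φ f) σ :=
  freeMap_tree φ hφ _

theorem freeMap_rightComb (e f : E) (σ : Perm (Fin 3)) :
    freeMap φ hφ 3 (rightComb ρ e f σ) = rightComb ρ' (φ e) (φ f) σ :=
  freeMap_tree φ hφ _

theorem freeMap_assocRel (e : E) :
    freeMap φ hφ 3 (assocRel ρ e) = assocRel ρ' (φ e) := by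
  rw [assocRel, map_sub, freeMap_leftComb, freeMap_rightComb, assocRel]

theorem freeMap_jacobiRel (e : E) :
    freeMap φ hφ 3 (jacobiRel ρ e) = jacobiRel ρ' (φ e) := by
  simp only [jacobiRel, map_add, freeMap_rightComb]

theorem freeMap_distribRel (c e : E) :
    freeMap φ hφ 3 (distribRel ρ c e) = distribRel ρ' (φ c) (φ e) := by
  simp only [distribRel, map_sub, freeMap_leftComb, freeMap_rightComb]

/-- Since `freeMap` commutes with the `S_3`-actions, only the defining relations have to be
transported, not all their relabellings. -/
theorem map_relSpan (S : Set (FreeSpace ρ 3)) :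
    (relSpan ρ S).map (freeMap φ hφ 3) = relSpan ρ' (freeMap φ hφ 3 '' S) := by
  rw [relSpan, relSpan, Submodule.map_span]
  congr 1
  ext x
  constructor
  · rintro ⟨_, ⟨σ, r, hr, rfl⟩, rfl⟩
    exact ⟨σ, _, ⟨r, hr, rfl⟩, freeMap_act φ hφ σ r⟩
  · rintro ⟨σ, _, ⟨r, hr, rfl⟩, rfl⟩
    exact ⟨_, ⟨σ, r, hr, rfl⟩, freeMap_act φ hφ σ r⟩

theorem freeMap_freeMap_of_leftInverse {φ : E →ₗ[k] F} {ψ : F →ₗ[k] E}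
    (hφ : ∀ e, φ (ρ (swap 0 1) e) = ρ' (swap 0 1) (φ e))
    (hψ : ∀ e, ψ (ρ' (swap 0 1) e) = ρ (swap 0 1) (ψ e)) (h : ∀ e, ψ (φ e) = e) {n : ℕ}
    (x : FreeSpace ρ n) : freeMap ψ hψ n (freeMap φ hφ n x) = x := by
  induction x using free_induction with
  | h0 => simp
  | hadd x y hx hy => simp only [map_add, hx, hy]
  | hsmul c x hx => simp only [map_smul, hx]
  | h t =>
    rw [freeMap_tree, freeMap_tree]
    refine congrArg _ (LTree.ext ((DTree.mapDec_mapDec _ _ t.1).trans ?_))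
    rw [show (ψ ∘ φ : E → E) = id from funext h, DTree.mapDec_id]

end FreeMap

/-! ### Homomorphisms between quotients -/

/-- The preimage of an ideal under a homomorphism of operads. -/
def Operad.Ideal.comap {k : Type u} [Field k] {P : Operad.{u, v} k} {Q : Operad.{u, w} k}
    (f : Operad.Hom P Q) (J : Q.Ideal) : P.Ideal where
  carrier n := (J.carrier n).comap (f.toFun n)
  act_mem n σ ν hν := by
    rw [Submodule.mem_comap, f.map_act]
    exact J.act_mem n σ _ hν
  circ_mem_left h i ν μ hν := by
    rw [Submodule.mem_comap, f.map_circ]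
    exact J.circ_mem_left h i _ _ hν
  circ_mem_right h i ν μ hμ := by
    rw [Submodule.mem_comap, f.map_circ]
    exact J.circ_mem_right h i _ _ hμ

theorem Operad.Ideal.subset_generatedBy {k : Type u} [Field k] (P : Operad.{u, v} k) {r : ℕ}
    (R : Set (P.obj r)) : R ⊆ (Operad.Ideal.generatedBy P R).carrier r := by
  intro x hx
  simp only [generatedBy, SetLike.mem_coe, Submodule.mem_iInf]
  exact fun I hI => hI hx

/-- Applied to the preimage of an ideal, this reduces well-definedness of a map of quotient operads,
in every arity, to a check on the relations. -/
theorem Operad.Ideal.generatedBy_le {k : Type u} [Field k] {P : Operad.{u, v} k} {r : ℕ}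
    {R : Set (P.obj r)} {I : P.Ideal} (hI : R ⊆ I.carrier r) (n : ℕ) :
    (Operad.Ideal.generatedBy P R).carrier n ≤ I.carrier n :=
  iInf₂_le I hI

/-- The homomorphism `P / I → Q / J` induced by a homomorphism `P → Q` that maps `I` to `J`. -/
def Operad.Hom.quotient {k : Type u} [Field k] {P : Operad.{u, v} k} {Q : Operad.{u, w} k}
    (f : Operad.Hom P Q) (I : P.Ideal) (J : Q.Ideal)
    (h : ∀ n, I.carrier n ≤ (J.carrier n).comap (f.toFun n)) :
    Operad.Hom (P.quotient I) (Q.quotient J) where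
  toFun n := (I.carrier n).mapQ (J.carrier n) (f.toFun n) (h n)
  map_one := congrArg (J.carrier 1).mkQ f.map_one
  map_circ hN i ν μ := by
    obtain ⟨ν, rfl⟩ := Submodule.Quotient.mk_surjective _ ν
    obtain ⟨μ, rfl⟩ := Submodule.Quotient.mk_surjective _ μ
    exact congrArg (J.carrier _).mkQ (f.map_circ hN i ν μ)
  map_act n σ ν := by
    obtain ⟨ν, rfl⟩ := Submodule.Quotient.mk_surjective _ ν
    exact congrArg (J.carrier _).mkQ (f.map_act n σ ν)

/-- Mutually inverse homomorphisms that preserve the relations induce mutually inverse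
homomorphisms between the quotients by the ideals generated by the relations. -/
def Operad.Iso.quotientGeneratedBy {k : Type u} [Field k] {P : Operad.{u, v} k}
    {Q : Operad.{u, w} k} (f : Operad.Iso P Q) {r : ℕ} (R : Set (P.obj r)) (S : Set (Q.obj r))
    (hf : ∀ x ∈ R, f.hom.toFun r x ∈ S) (hg : ∀ x ∈ S, f.inv.toFun r x ∈ R) :
    Operad.Iso (P.quotient (.generatedBy P R)) (Q.quotient (.generatedBy Q S)) where
  hom := f.hom.quotient _ _ (Operad.Ideal.generatedBy_le
    (I := Operad.Ideal.comap f.hom (.generatedBy Q S))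
    fun x hx => Operad.Ideal.subset_generatedBy Q S (hf x hx))
  inv := f.inv.quotient _ _ (Operad.Ideal.generatedBy_le
    (I := Operad.Ideal.comap f.inv (.generatedBy P R))
    fun x hx => Operad.Ideal.subset_generatedBy P R (hg x hx))
  inv_hom n x := by
    obtain ⟨x, rfl⟩ := Submodule.Quotient.mk_surjective _ x
    exact congrArg (Submodule.mkQ _) (f.inv_hom n x)
  hom_inv n x := by
    obtain ⟨x, rfl⟩ := Submodule.Quotient.mk_surjective _ x
    exact congrArg (Submodule.mkQ _) (f.hom_inv n x)

/-- An isomorphism of `S_2`-modules that identifies the relations of two quadratic presentations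
induces an isomorphism of operads. -/
noncomputable def QuadraticData.isoOfEquiv {k : Type u} [Field k] {D D' : QuadraticData k}
    (φ : D'.E ≃ₗ[k] D.E) (hφ : ∀ e, φ.toLinearMap (D'.ρ (swap 0 1) e) =
      D.ρ (swap 0 1) (φ.toLinearMap e))
    (hR : D'.R.map (freeMap φ.toLinearMap hφ 3) = D.R) : Operad.Iso D.operad D'.operad :=
  have hψ : ∀ e, φ.symm.toLinearMap (D.ρ (swap 0 1) e) =
      D'.ρ (swap 0 1) (φ.symm.toLinearMap e) := fun e => by
    have := hφ (φ.symm e)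
    simp only [LinearEquiv.coe_coe, LinearEquiv.apply_symm_apply] at this ⊢
    rw [← this, LinearEquiv.symm_apply_apply]
  Operad.Iso.quotientGeneratedBy
    { hom := freeHom φ.symm.toLinearMap hψ
      inv := freeHom φ.toLinearMap hφ
      inv_hom := fun _ => freeMap_freeMap_of_leftInverse hψ hφ φ.apply_symm_apply
      hom_inv := fun _ => freeMap_freeMap_of_leftInverse hφ hψ φ.symm_apply_apply }
    (r := 3) (D.R : Set (FreeSpace D.ρ 3)) (D'.R : Set (FreeSpace D'.ρ 3))
    (fun x hx => by
      have hx : x ∈ D.R := hx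
      rw [← hR] at hx
      obtain ⟨y, hy, rfl⟩ := hx
      -- Relations of `D` are images of relations of `D'`, so the inverse map brings them back to
      -- where they came from.
      exact (freeMap_freeMap_of_leftInverse hφ hψ φ.symm_apply_apply y).symm ▸ hy)
    (fun x hx => hR.le ⟨x, hx, rfl⟩)

/-! ### The trees with three leaves -/

theorem exists_perm_three {a b c : Fin 3} (hab : a ≠ b) (hac : a ≠ c) (hbc : b ≠ c) :
    ∃ σ : Perm (Fin 3), σ 0 = a ∧ σ 1 = b ∧ σ 2 = c := by
  revert a b c
  decide

/-- The two cosets of the alternating group, with the transposition on the right, where it only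
exchanges the inputs of the inner vertex of a left comb. -/
theorem perm_three_cases (σ : Perm (Fin 3)) : ∃ m : Fin 3,
    σ = finRotate 3 ^ (m : ℕ) ∨ σ = finRotate 3 ^ (m : ℕ) * swap 0 1 := by
  revert σ
  decide

theorem DTree.card_leaves_pos {E : Type v} {X : Type w} (t : DTree E X) :
    0 < t.leaves.card := by
  induction t with
  | leaf x => simp [leaves]
  | node e l r hl hr => simp [leaves, hl]

/-- A labelled tree with three leaves is a comb. -/
theorem LTree.eq_comb {E : Type v} (t : LTree E 3) :
    ∃ (e f : E) (σ : Perm (Fin 3)), t = leftCombTree e f σ ∨ t = rightCombTree e f σ := by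
  have hcard : t.1.leaves.card = 3 := by rw [t.leaves_eq]; rfl
  have hnodup : t.1.leaves.Nodup := by rw [t.leaves_eq]; exact Finset.univ.nodup
  obtain ⟨t, ht⟩ := t
  simp only at hcard hnodup
  -- Every subtree has a leaf, so counting leaves excludes all shapes except one inner vertex with
  -- two leaves beside a single leaf; distinctness of the three labels then provides `σ`.
  rcases t with a | ⟨e, a | ⟨f, l₁, l₂⟩, c | ⟨g, r₁, r₂⟩⟩
  · simp [DTree.leaves] at hcard
  · simp [DTree.leaves] at hcard
  · rcases r₁ with b | ⟨_, r₃, r₄⟩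
    · rcases r₂ with c | ⟨_, r₃, r₄⟩
      · simp [DTree.leaves] at hnodup
        obtain ⟨σ, rfl, rfl, rfl⟩ := exists_perm_three (a := a) (b := b) (c := c)
          (by tauto) (by tauto) (by tauto)
        exact ⟨e, g, σ, Or.inr rfl⟩
      · have := r₃.card_leaves_pos
        have := r₄.card_leaves_pos
        simp [DTree.leaves] at hcard
        omega
    · have := r₂.card_leaves_pos
      have := r₃.card_leaves_pos
      have := r₄.card_leaves_pos
      simp [DTree.leaves] at hcard
      omega
  · rcases l₁ with a | ⟨_, r₃, r₄⟩
    · rcases l₂ with b | ⟨_, r₃, r₄⟩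
      · simp [DTree.leaves] at hnodup
        obtain ⟨σ, rfl, rfl, rfl⟩ := exists_perm_three (a := a) (b := b) (c := c)
          (by tauto) (by tauto) (by tauto)
        exact ⟨e, f, σ, Or.inl rfl⟩
      · have := r₃.card_leaves_pos
        have := r₄.card_leaves_pos
        simp [DTree.leaves] at hcard
        omega
    · have := l₂.card_leaves_pos
      have := r₃.card_leaves_pos
      have := r₄.card_leaves_pos
      simp [DTree.leaves] at hcard
      omega
  · have := l₁.card_leaves_pos
    have := l₂.card_leaves_pos
    have := r₁.card_leaves_pos
    have := r₂.card_leaves_pos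
    simp [DTree.leaves] at hcard
    omega

/-! ### Relations between combs and spanning sets of `Free(E)(3)`. -/

section Combs

variable {k : Type u} [Field k] {E : Type v} [AddCommGroup E] [Module k E]
  {ρ : Representation k (Perm (Fin 2)) E}

theorem leftComb_mul_swap (e f : E) (σ : Perm (Fin 3)) :
    leftComb ρ e f (σ * swap 0 1) = leftComb ρ e (ρ (swap 0 1) f) σ :=
  (tree_swap (.left e _ (.root f _ _))).symm

/-- Equivariance at the root moves the inner vertex to the left, so the labels are read in the order
`σ(2), σ(3), σ(1)`. Hence left combs alone span `Free(E)(3)`. -/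
theorem rightComb_eq_leftComb (e f : E) (σ : Perm (Fin 3)) :
    rightComb ρ e f σ = leftComb ρ (ρ (swap 0 1) e) f (σ * finRotate 3) :=
  (tree_swap (.root e _ _)).symm

theorem freeAct_leftComb (e f : E) (σ τ : Perm (Fin 3)) :
    freeAct ρ 3 τ (leftComb ρ e f σ) = leftComb ρ e f (τ * σ) :=
  freeAct_tree τ _

theorem leftComb_lin_left (a b : k) (e₁ e₂ f : E) (σ : Perm (Fin 3)) :
    leftComb ρ (a • e₁ + b • e₂) f σ = a • leftComb ρ e₁ f σ + b • leftComb ρ e₂ f σ :=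
  tree_lin (.root ..)

theorem leftComb_lin_right (a b : k) (e f₁ f₂ : E) (σ : Perm (Fin 3)) :
    leftComb ρ e (a • f₁ + b • f₂) σ = a • leftComb ρ e f₁ σ + b • leftComb ρ e f₂ σ :=
  tree_lin (.left _ _ (.root ..))

theorem leftComb_neg_left (e f : E) (σ : Perm (Fin 3)) :
    leftComb ρ (-e) f σ = -leftComb ρ e f σ := by
  simpa using leftComb_lin_left (ρ := ρ) (-1) 0 e 0 f σ

theorem leftComb_neg_right (e f : E) (σ : Perm (Fin 3)) :
    leftComb ρ e (-f) σ = -leftComb ρ e f σ := by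
  simpa using leftComb_lin_right (ρ := ρ) (-1) 0 e f 0 σ

theorem eq_top_of_leftComb_mem {W : Submodule k (FreeSpace ρ 3)}
    (h : ∀ e f σ, leftComb ρ e f σ ∈ W) : W = ⊤ := by
  refine Submodule.eq_top_iff'.2 fun x => ?_
  induction x using free_induction with
  | h0 => exact W.zero_mem
  | hadd x y hx hy => exact W.add_mem hx hy
  | hsmul c x hx => exact W.smul_mem c hx
  | h t =>
    obtain ⟨e, f, σ, rfl | rfl⟩ := t.eq_comb
    · exact h e f σ
    · have := h (ρ (swap 0 1) e) f (σ * finRotate 3)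
      rwa [← rightComb_eq_leftComb] at this

theorem eq_top_of_leftComb_basis_mem {W : Submodule k (FreeSpace ρ 3)} {B : Set E}
    (hB : Submodule.span k B = ⊤) (h : ∀ e ∈ B, ∀ f ∈ B, ∀ σ, leftComb ρ e f σ ∈ W) :
    W = ⊤ := by
  refine eq_top_of_leftComb_mem fun e f σ => ?_
  have he : e ∈ Submodule.span k B := hB ▸ Submodule.mem_top
  have hf : f ∈ Submodule.span k B := hB ▸ Submodule.mem_top
  induction he using Submodule.span_induction with
  | zero =>
    -- The tree relations encode linearity only as two-term combinations; zero, sums and scalar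
    -- multiples arise from special coefficients.
    have := leftComb_lin_left (ρ := ρ) 0 0 0 0 f σ
    simp only [zero_smul, add_zero] at this
    exact this ▸ W.zero_mem
  | add x y _ _ hx hy =>
    have := leftComb_lin_left (ρ := ρ) 1 1 x y f σ
    simp only [one_smul] at this
    exact this ▸ W.add_mem hx hy
  | smul c x _ hx =>
    have := leftComb_lin_left (ρ := ρ) c 0 x 0 f σ
    simp only [zero_smul, add_zero] at this
    exact this ▸ W.smul_mem c hx
  | mem e he =>
  induction hf using Submodule.span_induction with
  | zero =>
    have := leftComb_lin_right (ρ := ρ) 0 0 e 0 0 σ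
    simp only [zero_smul, add_zero] at this
    exact this ▸ W.zero_mem
  | add x y _ _ hx hy =>
    have := leftComb_lin_right (ρ := ρ) 1 1 e x y σ
    simp only [one_smul] at this
    exact this ▸ W.add_mem hx hy
  | smul c x _ hx =>
    have := leftComb_lin_right (ρ := ρ) c 0 e x 0 σ
    simp only [zero_smul, add_zero] at this
    exact this ▸ W.smul_mem c hx
  | mem f hf => exact h e he f hf σ

/-- If `E` is spanned by eigenvectors of `(12)`, then `Free(E)(3)` is spanned by the cyclic
relabellings of `e (f (1, 2), 3)`. -/
theorem eq_top_of_leftComb_rotate_mem {W : Submodule k (FreeSpace ρ 3)} {B : Set E}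
    (hB : Submodule.span k B = ⊤)
    (hs : ∀ e ∈ B, ρ (swap 0 1) e = e ∨ ρ (swap 0 1) e = -e)
    (h : ∀ e ∈ B, ∀ f ∈ B, ∀ m : Fin 3, leftComb ρ e f (finRotate 3 ^ (m : ℕ)) ∈ W) :
    W = ⊤ := by
  refine eq_top_of_leftComb_basis_mem hB fun e he f hf σ => ?_
  obtain ⟨m, rfl | rfl⟩ := perm_three_cases σ
  · exact h e he f hf m
  · rw [leftComb_mul_swap]
    rcases hs f hf with h' | h' <;> rw [h']
    · exact h e he f hf m
    · rw [leftComb_neg_right]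
      exact W.neg_mem (h e he f hf m)

/-! ### The pairing of combs -/

/-- At the root, the crossed summand compares a leaf with a vertex and vanishes. At the inner
vertex, the direct or the crossed summand can survive, according to whether the labels agree as they
stand or after exchanging the first two. -/
theorem pairing_leftComb_leftComb (α β : Module.Dual k E) (e f : E) (σ τ : Perm (Fin 3)) :
    pairing ρ (leftComb (czechDual ρ) α β σ) (leftComb ρ e f τ) =
      ((Perm.sign σ : ℤ) : k) * (α e * (if σ = τ then β f else
        if σ * swap 0 1 = τ then β (ρ (swap 0 1) f) else 0)) := by
  rw [leftComb, leftComb, pairing_tree]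
  simp only [leftCombTree, DTree.combSign, DTree.pair, sgn3_perm, mul_zero, add_zero]
  congr 2
  have h1 : σ = τ ↔ σ 0 = τ 0 ∧ σ 1 = τ 1 ∧ σ 2 = τ 2 := by revert σ τ; decide
  have h2 : σ * swap 0 1 = τ ↔ σ 0 = τ 1 ∧ σ 1 = τ 0 ∧ σ 2 = τ 2 := by revert σ τ; decide
  have h3 : τ 0 ≠ τ 1 := τ.injective.ne (by decide)
  simp only [h1, h2]
  by_cases a : σ 0 = τ 0
  · by_cases b : σ 1 = τ 1 <;> by_cases c : σ 2 = τ 2 <;> simp [a, b, c, h3]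
  · by_cases a' : σ 0 = τ 1 <;> by_cases b : σ 1 = τ 0 <;> by_cases c : σ 2 = τ 2 <;>
      simp [a, a', b, c, h3.symm]

/-! ### Annihilators -/

theorem freeAct_mem_relSpan {S : Set (FreeSpace ρ 3)} {r : FreeSpace ρ 3} (hr : r ∈ S)
    (σ : Perm (Fin 3)) : freeAct ρ 3 σ r ∈ relSpan ρ S :=
  Submodule.subset_span ⟨σ, r, hr, rfl⟩

/-- The pairing is equivariant up to sign, so `⟨σ x, τ y⟩ = ± ⟨x, σ⁻¹ τ y⟩` and only one side needs
to be relabelled. -/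
theorem relSpan_le_ann {S : Set (FreeSpace ρ 3)} {S' : Set (FreeSpace (czechDual ρ) 3)}
    (h : ∀ x ∈ S', ∀ y ∈ S, ∀ τ, pairing ρ x (freeAct ρ 3 τ y) = 0) :
    relSpan (czechDual ρ) S' ≤ ann ρ (relSpan ρ S) := by
  refine Submodule.span_le.2 ?_
  rintro _ ⟨σ, x, hx, rfl⟩
  refine mem_ann.2 fun y hy => ?_
  induction hy using Submodule.span_induction with
  | zero => simp
  | add x y _ _ hx hy => rw [map_add, hx, hy, add_zero]
  | smul c x _ hx => rw [map_smul, hx, smul_zero]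
  | mem y hy =>
    obtain ⟨τ, y, hy, rfl⟩ := hy
    have := pairing_act ρ σ x (freeAct ρ 3 (σ⁻¹ * τ) y)
    rwa [h x hx y hy, mul_zero, ← Module.End.mul_apply, ← map_mul, mul_inv_cancel_left] at this

/-- A subspace `T` of `Ann(R)` is equal to `Ann(R)` if it spans everything together with
elements for which there is a dual family in `R`. -/
theorem eq_ann_of_sup_eq_top {ι : Type*} [Fintype ι] {R : Submodule k (FreeSpace ρ 3)}
    {T : Submodule k (FreeSpace (czechDual ρ) 3)} (hT : T ≤ ann ρ R)
    (v : ι → FreeSpace (czechDual ρ) 3) (r : ι → FreeSpace ρ 3) (hr : ∀ i, r i ∈ R)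
    (h₀ : ∀ i j, i ≠ j → pairing ρ (v i) (r j) = 0) (h₁ : ∀ i, pairing ρ (v i) (r i) ≠ 0)
    (htop : ∀ W : Submodule k (FreeSpace (czechDual ρ) 3), T ≤ W → (∀ i, v i ∈ W) → W = ⊤) :
    T = ann ρ R := by
  refine le_antisymm hT fun x hx => ?_
  -- Write `x = t + ∑ c i • v i` with `t ∈ T`. Pairing with `r j` kills `x`, `t` and all `v i` with
  -- `i ≠ j`, which forces `c j = 0`.
  obtain ⟨t, ht, y, hy, rfl⟩ := Submodule.mem_sup.1 (htop _ le_sup_left (fun i => Submodule.mem_sup_right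
    (Submodule.subset_span (Set.mem_range_self i))) ▸ Submodule.mem_top : x ∈ _)
  obtain ⟨c, rfl⟩ := (Submodule.mem_span_range_iff_exists_fun k).1 hy
  have hc : ∀ j, c j = 0 := fun j => by
    have h := mem_ann.1 hx _ (hr j)
    rw [map_add, LinearMap.add_apply, mem_ann.1 (hT ht) _ (hr j), zero_add, map_sum,
      LinearMap.sum_apply, Finset.sum_eq_single j (fun i _ hij => by simp [h₀ i j hij])
        (fun hj => (hj (Finset.mem_univ j)).elim)] at h
    simpa [h₁ j] using h
  simpa [hc] using ht

end Combs

/-! ### The quadratic duals of the four operads -/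

section Duals

variable {k : Type u} [Field k] {E : Type v} [AddCommGroup E] [Module k E]
  {ρ : Representation k (Perm (Fin 2)) E}

theorem czechDual_swap_apply (α : Module.Dual k E) (v : E) :
    czechDual ρ (swap 0 1) α v = -α (ρ (swap 0 1) v) := by
  rw [czechDual_apply]
  simp

/-! ### Cyclic left combs and their pairing. -/

/-- The cyclic permutations of the three inputs. -/
def rotation (m : Fin 3) : Perm (Fin 3) := finRotate 3 ^ (m : ℕ)

/-- The cyclic relabellings of `e (f (1, 2), 3)`. -/
noncomputable def rotComb (ρ : Representation k (Perm (Fin 2)) E) (i : Fin 3) (e f : E) :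
    FreeSpace ρ 3 :=
  leftComb ρ e f (rotation i)

theorem rotComb_neg_right (i : Fin 3) (e f : E) : rotComb ρ i e (-f) = -rotComb ρ i e f :=
  leftComb_neg_right e f _

theorem freeAct_rotate_rotComb (m i : Fin 3) (e f : E) :
    freeAct ρ 3 (rotation m) (rotComb ρ i e f) = rotComb ρ (m + i) e f := by
  rw [rotComb, rotComb, freeAct_leftComb]
  congr 1
  revert m i
  decide

/-- Conjugation by the transposition inverts rotations, hence `m - i`; the transposition that
remains on the right acts on the inner decoration. -/
theorem freeAct_reflect_rotComb (m i : Fin 3) (e f : E) :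
    freeAct ρ 3 (rotation m * swap 0 1) (rotComb ρ i e f) =
      rotComb ρ (m - i) e (ρ (swap 0 1) f) := by
  rw [rotComb, rotComb, freeAct_leftComb, ← leftComb_mul_swap]
  congr 1
  revert m i
  decide

/-- Rotations are even, so no sign appears, and no rotation composed with a transposition is a
rotation, so the crossed term drops out. -/
theorem pairing_rotComb (α β : Module.Dual k E) (e f : E) (i j : Fin 3) :
    pairing ρ (rotComb (czechDual ρ) i α β) (rotComb ρ j e f) =
      if i = j then α e * β f else 0 := by
  have h1 : (rotation i = rotation j) ↔ i = j := by
    revert i j; decide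
  have h2 : rotation i * swap 0 1 ≠ rotation j := by
    revert i j; decide
  have h3 : Perm.sign (rotation i) = 1 := by
    clear h1 h2; revert i; decide
  rw [rotComb, rotComb, pairing_leftComb_leftComb, if_neg h2, h3]
  simp [h1]

/-! ### The relations in terms of cyclic left combs, and what they generate. -/

theorem assocRel_eq (e : E) :
    assocRel ρ e = rotComb ρ 0 e e - rotComb ρ 1 (ρ (swap 0 1) e) e := by
  rw [assocRel, rightComb_eq_leftComb, one_mul]
  rfl

theorem jacobiRel_eq {e : E} (he : ρ (swap 0 1) e = -e) :
    jacobiRel ρ e = -(rotComb ρ 0 e e + rotComb ρ 1 e e + rotComb ρ 2 e e) := by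
  have h : finRotate 3 ^ 3 = 1 := by decide
  simp only [jacobiRel, rightComb_eq_leftComb, he, leftComb_neg_left, one_mul, ← pow_succ,
    ← pow_two, Nat.reduceAdd, h]
  change -rotComb ρ 1 e e + -rotComb ρ 2 e e + -rotComb ρ 0 e e = _
  abel

theorem distribRel_eq {c e : E} (hc : ρ (swap 0 1) c = c) (he : ρ (swap 0 1) e = -e) :
    distribRel ρ c e = -(rotComb ρ 1 e c - rotComb ρ 2 c e + rotComb ρ 0 c e) := by
  have h : (swap 0 1 * finRotate 3 : Perm (Fin 3)) = finRotate 3 ^ 2 * swap 0 1 := by decide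
  simp only [distribRel, rightComb_eq_leftComb, h, leftComb_mul_swap, hc, he, leftComb_neg_left,
    leftComb_neg_right, one_mul]
  change -rotComb ρ 1 e c - -rotComb ρ 2 c e - rotComb ρ 0 c e = _
  abel

theorem relSpan_le_ann_of_rotate {S : Set (FreeSpace ρ 3)}
    {S' : Set (FreeSpace (czechDual ρ) 3)}
    (h : ∀ x ∈ S', ∀ y ∈ S, ∀ m : Fin 3,
      pairing ρ x (freeAct ρ 3 (rotation m) y) = 0 ∧
      pairing ρ x (freeAct ρ 3 (rotation m * swap 0 1) y) = 0) :
    relSpan (czechDual ρ) S' ≤ ann ρ (relSpan ρ S) := by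
  refine relSpan_le_ann fun x hx y hy τ => ?_
  obtain ⟨m, rfl | rfl⟩ := perm_three_cases τ
  exacts [(h x hx y hy m).1, (h x hx y hy m).2]

theorem eq_top_of_rotComb_mem {W : Submodule k (FreeSpace ρ 3)} {B : Set E}
    (hB : Submodule.span k B = ⊤)
    (hs : ∀ e ∈ B, ρ (swap 0 1) e = e ∨ ρ (swap 0 1) e = -e)
    (h : ∀ e ∈ B, ∀ f ∈ B, ∀ i, rotComb ρ i e f ∈ W) : W = ⊤ :=
  eq_top_of_leftComb_rotate_mem hB hs h

/-- For a commutative generator, the rotated associativity relations are the differences of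
consecutive cyclic combs, so modulo `W` all three are equal. -/
theorem rotComb_mem_of_assocRel {W : Submodule k (FreeSpace ρ 3)} {S : Set (FreeSpace ρ 3)}
    (hS : relSpan ρ S ≤ W) {e : E} (he : ρ (swap 0 1) e = e) (hr : assocRel ρ e ∈ S)
    (h0 : rotComb ρ 0 e e ∈ W) (i : Fin 3) : rotComb ρ i e e ∈ W := by
  have h (m : Fin 3) := hS (freeAct_mem_relSpan hr (rotation m))
  simp only [assocRel_eq, he, map_sub, freeAct_rotate_rotComb] at h
  have h1 := (Submodule.sub_mem_iff_right _ h0).1 (h 0)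
  have h2 := (Submodule.sub_mem_iff_right _ h1).1 (h 1)
  fin_cases i
  exacts [h0, h1, h2]

/-- The Jacobi relation is, up to sign, the sum of the three cyclic combs, so two of them determine
the third. -/
theorem rotComb_mem_of_jacobiRel {W : Submodule k (FreeSpace ρ 3)} {S : Set (FreeSpace ρ 3)}
    (hS : relSpan ρ S ≤ W) {e : E} (he : ρ (swap 0 1) e = -e) (hr : jacobiRel ρ e ∈ S)
    (h1 : rotComb ρ 1 e e ∈ W) (h2 : rotComb ρ 2 e e ∈ W) (i : Fin 3) :
    rotComb ρ i e e ∈ W := by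
  have h := hS (freeAct_mem_relSpan hr 1)
  rw [map_one, Module.End.one_apply, jacobiRel_eq he, Submodule.neg_mem_iff,
    Submodule.add_mem_iff_left _ h2, Submodule.add_mem_iff_left _ h1] at h
  fin_cases i
  exacts [h, h1, h2]

/-- Distributivity is a rewriting rule: a bracket with a product becomes a combination of products
with a bracket. -/
theorem rotComb_mem_of_distribRel {W : Submodule k (FreeSpace ρ 3)} {S : Set (FreeSpace ρ 3)}
    (hS : relSpan ρ S ≤ W) {c e : E} (hc : ρ (swap 0 1) c = c) (he : ρ (swap 0 1) e = -e)
    (hr : distribRel ρ c e ∈ S) (h : ∀ i, rotComb ρ i c e ∈ W) (i : Fin 3) :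
    rotComb ρ i e c ∈ W := by
  -- In `distribRel` the comb with `e` at the root has index 1, so rotating by `i - 1` moves it to
  -- index `i`.
  have hd := hS (freeAct_mem_relSpan hr (rotation (i - 1)))
  simp only [distribRel_eq hc he, map_neg, map_add, map_sub, freeAct_rotate_rotComb,
    Submodule.neg_mem_iff] at hd
  rwa [Submodule.add_mem_iff_left _ (h _), Submodule.sub_mem_iff_left _ (h _),
    sub_add_cancel] at hd

/-! ### Computation of the four annihilators. -/

theorem ann_relSpan_assocRel_of_comm {e : E} (he : ρ (swap 0 1) e = e) {α : Module.Dual k E}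
    (hα : czechDual ρ (swap 0 1) α = -α) (hαe : α e = 1) (hspan : Submodule.span k {α} = ⊤) :
    relSpan (czechDual ρ) {jacobiRel (czechDual ρ) α} = ann ρ (relSpan ρ {assocRel ρ e}) := by
  -- The rotations 0 and 2 turn associativity into "comb 0 minus comb 1" and "comb 2 minus comb 0".
  -- Each involves exactly one of the combs 1 and 2, which makes the pairing matrix diagonal; the
  -- third rotation would involve both.
  refine eq_ann_of_sup_eq_top (ι := Fin 2) (relSpan_le_ann_of_rotate ?_)
    ![rotComb (czechDual ρ) 1 α α, rotComb (czechDual ρ) 2 α α]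
    ![freeAct ρ 3 (rotation 0) (assocRel ρ e),
      freeAct ρ 3 (rotation 2) (assocRel ρ e)] ?_ ?_ ?_ ?_
  · rintro _ rfl _ rfl m
    simp only [jacobiRel_eq hα, assocRel_eq, he, freeAct_rotate_rotComb, freeAct_reflect_rotComb,
      pairing_rotComb, hαe, map_sub, map_add, map_neg, LinearMap.add_apply, LinearMap.neg_apply]
    fin_cases m <;> simp +decide
  · intro i
    fin_cases i <;> exact freeAct_mem_relSpan (Set.mem_singleton _) _
  · simp only [Fin.forall_fin_two, Matrix.cons_val_zero, Matrix.cons_val_one, assocRel_eq, he,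
      freeAct_rotate_rotComb, pairing_rotComb, hαe, map_sub]
    simp
  · simp only [Fin.forall_fin_two, Matrix.cons_val_zero, Matrix.cons_val_one, assocRel_eq, he,
      freeAct_rotate_rotComb, pairing_rotComb, hαe, map_sub]
    simp
  · intro W hT hv
    refine eq_top_of_rotComb_mem hspan ?_ ?_
    · rintro _ rfl
      exact Or.inr hα
    · rintro _ rfl _ rfl
      exact rotComb_mem_of_jacobiRel hT hα (Set.mem_singleton _) (hv 0) (hv 1)

theorem ann_relSpan_jacobiRel {e : E} (he : ρ (swap 0 1) e = -e) {α : Module.Dual k E}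
    (hα : czechDual ρ (swap 0 1) α = α) (hαe : α e = 1) (hspan : Submodule.span k {α} = ⊤) :
    relSpan (czechDual ρ) {assocRel (czechDual ρ) α} = ann ρ (relSpan ρ {jacobiRel ρ e}) := by
  -- The roles are reversed: modulo associativity a single comb spans, and it pairs to `-1` with the
  -- Jacobi relation.
  refine eq_ann_of_sup_eq_top (ι := Unit) (relSpan_le_ann_of_rotate ?_)
    (fun _ => rotComb (czechDual ρ) 0 α α) (fun _ => freeAct ρ 3 1 (jacobiRel ρ e))
    (fun _ => freeAct_mem_relSpan (Set.mem_singleton _) _) (fun i j hij => (hij rfl).elim) ?_ ?_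
  · rintro _ rfl _ rfl m
    simp only [jacobiRel_eq he, assocRel_eq, he, hα, freeAct_rotate_rotComb,
      freeAct_reflect_rotComb, rotComb_neg_right, pairing_rotComb, hαe, map_sub, map_add, map_neg,
      LinearMap.sub_apply]
    fin_cases m <;> simp +decide
  · simp [jacobiRel_eq he, pairing_rotComb, hαe]
  · intro W hT hv
    refine eq_top_of_rotComb_mem hspan ?_ ?_
    · rintro _ rfl
      exact Or.inl hα
    · rintro _ rfl _ rfl
      exact rotComb_mem_of_assocRel hT hα (Set.mem_singleton _) (hv ())

/-- Here `(12)` permutes the generators up to sign, so all six labellings are used. The right comb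
in the relation becomes a left comb with root `(12) e`, on which `α` vanishes; hence the combs with
both decorations `α` are dual, up to sign, to the relabelled relations. -/
theorem ann_relSpan_assocRel {e : E} {α : Module.Dual k E} (hαe : α e = 1)
    (hαs : α (ρ (swap 0 1) e) = 0)
    (hspan : Submodule.span k {α, czechDual ρ (swap 0 1) α} = ⊤) :
    relSpan (czechDual ρ) {assocRel (czechDual ρ) α} = ann ρ (relSpan ρ {assocRel ρ e}) := by
  refine eq_ann_of_sup_eq_top (ι := Perm (Fin 3)) (relSpan_le_ann_of_rotate ?_)
    (fun σ => leftComb (czechDual ρ) α α σ) (fun σ => freeAct ρ 3 σ (assocRel ρ e))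
    (fun _ => freeAct_mem_relSpan (Set.mem_singleton _) _) ?_ ?_ ?_
  · rintro _ rfl _ rfl m
    simp only [assocRel_eq, freeAct_rotate_rotComb, freeAct_reflect_rotComb, pairing_rotComb,
      czechDual_swap_apply, DTree.swap_swap_apply, hαe, hαs, map_sub, LinearMap.sub_apply]
    fin_cases m <;> simp +decide
  · intro σ τ h
    simp [assocRel, rightComb_eq_leftComb, freeAct_leftComb, pairing_leftComb_leftComb, hαe, hαs,
      h]
  · intro σ
    have : ((Perm.sign σ : ℤ) : k) ≠ 0 := by
      rcases Int.units_eq_one_or (Perm.sign σ) with h | h <;> simp [h]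
    simpa [assocRel, rightComb_eq_leftComb, freeAct_leftComb, pairing_leftComb_leftComb, hαe, hαs]
      using this
  · intro W hT h0
    have h1 (σ : Perm (Fin 3)) :
        leftComb (czechDual ρ) (czechDual ρ (swap 0 1) α) α σ ∈ W := by
      -- The shift by the inverse rotation compensates the rotation from `rightComb_eq_leftComb`, so
      -- the term with root `(12) α` gets exactly the labelling `σ`.
      have hr : freeAct (czechDual ρ) 3 (σ * (finRotate 3)⁻¹) (assocRel (czechDual ρ) α) ∈ W :=
        hT (freeAct_mem_relSpan (Set.mem_singleton _) _)
      rw [assocRel, rightComb_eq_leftComb, one_mul, map_sub, freeAct_leftComb, freeAct_leftComb,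
        inv_mul_cancel_right] at hr
      exact (Submodule.sub_mem_iff_right _ (h0 _)).1 hr
    refine eq_top_of_leftComb_basis_mem hspan ?_
    rintro _ (rfl | rfl) _ (rfl | rfl) σ
    · exact h0 σ
    -- A transposed inner decoration is absorbed into the labelling, and all labellings are already
    -- covered.
    · rw [← leftComb_mul_swap]
      exact h0 (σ * swap 0 1)
    · exact h1 σ
    · rw [← leftComb_mul_swap]
      exact h1 _

/-- Modulo the Poisson relations six combs span: one with two products, two with two brackets, and
three with a product at the root and a bracket inside. -/
theorem eq_top_of_poisson_le {c e : E} (hc : ρ (swap 0 1) c = c) (he : ρ (swap 0 1) e = -e)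
    (hspan : Submodule.span k {c, e} = ⊤) {W : Submodule k (FreeSpace ρ 3)}
    (hW : relSpan ρ {assocRel ρ c, jacobiRel ρ e, distribRel ρ c e} ≤ W)
    (hcc : rotComb ρ 0 c c ∈ W) (he₁ : rotComb ρ 1 e e ∈ W) (he₂ : rotComb ρ 2 e e ∈ W)
    (hce : ∀ i, rotComb ρ i c e ∈ W) : W = ⊤ := by
  refine eq_top_of_rotComb_mem hspan ?_ ?_
  · rintro _ (rfl | rfl)
    exacts [Or.inl hc, Or.inr he]
  · rintro _ (rfl | rfl) _ (rfl | rfl)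
    · exact rotComb_mem_of_assocRel hW hc (Set.mem_insert _ _) hcc
    · exact hce
    · exact rotComb_mem_of_distribRel hW hc he
        (Set.mem_insert_of_mem _ (Set.mem_insert_of_mem _ (Set.mem_singleton _))) hce
    · exact rotComb_mem_of_jacobiRel hW he
        (Set.mem_insert_of_mem _ (Set.mem_insert _ _)) he₁ he₂

theorem relSpan_poisson_le_ann {c e : E} (hc : ρ (swap 0 1) c = c) (he : ρ (swap 0 1) e = -e)
    {α β : Module.Dual k E} (hα : czechDual ρ (swap 0 1) α = α)
    (hβ : czechDual ρ (swap 0 1) β = -β) (hαc : α c = 0) (hαe : α e = 1) (hβc : β c = 1)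
    (hβe : β e = 0) :
    relSpan (czechDual ρ) {assocRel (czechDual ρ) α, jacobiRel (czechDual ρ) β,
      distribRel (czechDual ρ) α β} ≤
      ann ρ (relSpan ρ {assocRel ρ c, jacobiRel ρ e, distribRel ρ c e}) := by
  refine relSpan_le_ann_of_rotate ?_
  -- Of the nine pairs of relations, six vanish because the decorations do not match. What remains
  -- is associativity against Jacobi, Jacobi against associativity, and distributivity against
  -- itself.
  rintro _ (rfl | rfl | rfl) _ (rfl | rfl | rfl) m <;>
    simp only [jacobiRel_eq he, jacobiRel_eq hβ, distribRel_eq hc he, distribRel_eq hα hβ,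
      assocRel_eq, hc, he, hα, freeAct_rotate_rotComb, freeAct_reflect_rotComb,
      rotComb_neg_right, pairing_rotComb, hαc, hαe, hβc, hβe, map_sub, map_add, map_neg,
      LinearMap.sub_apply, LinearMap.add_apply, LinearMap.neg_apply, mul_zero, zero_mul,
      ite_self, add_zero, sub_zero, neg_zero, and_self] <;>
    fin_cases m <;> simp +decide

theorem ann_relSpan_poisson {c e : E} (hc : ρ (swap 0 1) c = c) (he : ρ (swap 0 1) e = -e)
    {α β : Module.Dual k E} (hα : czechDual ρ (swap 0 1) α = α)
    (hβ : czechDual ρ (swap 0 1) β = -β) (hαc : α c = 0) (hαe : α e = 1) (hβc : β c = 1)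
    (hβe : β e = 0) (hspan : Submodule.span k {α, β} = ⊤) :
    relSpan (czechDual ρ) {assocRel (czechDual ρ) α, jacobiRel (czechDual ρ) β,
      distribRel (czechDual ρ) α β} =
      ann ρ (relSpan ρ {assocRel ρ c, jacobiRel ρ e, distribRel ρ c e}) := by
  -- Since `α` is dual to `e` and `β` to `c`, combs in `α, α` detect Jacobi, combs in `β, β` detect
  -- associativity as in the commutative case, and combs in `α, β` detect distributivity through its
  -- only term with root `e`. That term has index 1 before rotation, so the combs 0, 1, 2 match the
  -- rotations 2, 0, 1.
  refine eq_ann_of_sup_eq_top (ι := Fin 6) (relSpan_poisson_le_ann hc he hα hβ hαc hαe hβc hβe)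
    ![rotComb (czechDual ρ) 0 α α, rotComb (czechDual ρ) 1 β β, rotComb (czechDual ρ) 2 β β,
      rotComb (czechDual ρ) 0 α β, rotComb (czechDual ρ) 1 α β, rotComb (czechDual ρ) 2 α β]
    ![freeAct ρ 3 (rotation 0) (jacobiRel ρ e),
      freeAct ρ 3 (rotation 0) (assocRel ρ c),
      freeAct ρ 3 (rotation 2) (assocRel ρ c),
      freeAct ρ 3 (rotation 2) (distribRel ρ c e),
      freeAct ρ 3 (rotation 0) (distribRel ρ c e),
      freeAct ρ 3 (rotation 1) (distribRel ρ c e)]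
    ?_ ?_ ?_ ?_
  · intro i
    fin_cases i <;> exact freeAct_mem_relSpan (by simp) _
  · intro i j hij
    fin_cases i <;> fin_cases j <;> first
      | exact (hij rfl).elim
      | simp +decide [jacobiRel_eq he, distribRel_eq hc he, assocRel_eq, hc, freeAct_rotate_rotComb,
          pairing_rotComb, hαc, hαe, hβc, hβe]
  · intro i
    fin_cases i <;>
      simp +decide [jacobiRel_eq he, distribRel_eq hc he, assocRel_eq, hc, freeAct_rotate_rotComb,
        pairing_rotComb, hαe, hβc]
  · intro W hT hv
    refine eq_top_of_poisson_le hα hβ hspan hT (hv 0) (hv 1) (hv 2) fun i => ?_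
    fin_cases i
    exacts [hv 3, hv 4, hv 5]

end Duals

/-- If the presentation `(F, S)` is identified with `(E^∨, Ann(R))` by `φ : F ≃ E^∨`, then the
quadratic dual of `Q(E, R)` is isomorphic to `Q(F, S)`. -/
theorem QuadraticData.nonempty_iso_dual {k : Type u} [Field k] {E F : Type u}
    [AddCommGroup E] [Module k E] [FiniteDimensional k E]
    [AddCommGroup F] [Module k F] [FiniteDimensional k F]
    {ρ : Representation k (Perm (Fin 2)) E} {ρ' : Representation k (Perm (Fin 2)) F}
    {R : Set (FreeSpace ρ 3)} {S : Set (FreeSpace ρ' 3)} (φ : F ≃ₗ[k] Module.Dual k E)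
    (hφ : ∀ e, φ.toLinearMap (ρ' (swap 0 1) e) = czechDual ρ (swap 0 1) (φ.toLinearMap e))
    (hS : relSpan (czechDual ρ) (freeMap φ.toLinearMap hφ 3 '' S) = ann ρ (relSpan ρ R)) :
    Nonempty (Operad.Iso (QuadraticData.ofRelations ρ R).dual.operad
      (QuadraticData.ofRelations ρ' S).operad) :=
  ⟨QuadraticData.isoOfEquiv (D := (QuadraticData.ofRelations ρ R).dual)
    (D' := QuadraticData.ofRelations ρ' S) φ hφ ((map_relSpan φ.toLinearMap hφ S).trans hS)⟩

/-! ### The identifications of the generators with their duals. -/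

section Examples

variable (k : Type u) [Field k]

theorem span_one_eq_top : Submodule.span k {(1 : k)} = ⊤ :=
  Submodule.eq_top_iff'.2 fun x => Submodule.mem_span_singleton.2 ⟨x, by simp⟩

theorem signTwist_trivial_swap (x : k) :
    signTwist (Representation.trivial k (Perm (Fin 2)) k) (swap 0 1) x = -x := by
  simp [signTwist]

theorem poissRep_swap (x : k × k) : poissRep k (swap 0 1) x = (x.1, -x.2) := by
  simp [poissRep, Representation.prod, signTwist]

theorem assRep_swap (x : Fin 2 → k) : assRep k (swap 0 1) x = ![x 1, x 0] := by
  ext i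
  fin_cases i <;> simp [assRep, LinearMap.funLeft]

/-- The identification of `k` with its dual. -/
def selfDual : k ≃ₗ[k] Module.Dual k k where
  toFun := LinearMap.mul k k
  map_add' := map_add _
  map_smul' := map_smul _
  invFun f := f 1
  left_inv := mul_one
  right_inv f := by ext; simp

/-- The identification of the generators of `Poiss` with their dual, which interchanges the
commutative generator and the Lie generator. -/
def poissDual : (k × k) ≃ₗ[k] Module.Dual k (k × k) where
  toFun x := x.2 • LinearMap.fst k k k + x.1 • LinearMap.snd k k k
  map_add' x y := by ext <;> simp
  map_smul' c x := by ext <;> simp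
  invFun f := (f (0, 1), f (1, 0))
  left_inv x := by simp
  right_inv f := by ext <;> simp

/-- The identification of the generators of `Ass` with their dual, with a sign for the second
generator. -/
def assDual : (Fin 2 → k) ≃ₗ[k] Module.Dual k (Fin 2 → k) where
  toFun x := x 0 • LinearMap.proj 0 - x 1 • LinearMap.proj 1
  map_add' x y := by ext i; fin_cases i <;> simp [add_comm]
  map_smul' c x := by ext i; fin_cases i <;> simp
  invFun f := ![f (Pi.single 0 1), -f (Pi.single 1 1)]
  left_inv x := by ext i; fin_cases i <;> simp
  right_inv f := by ext i; fin_cases i <;> simp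

theorem nonempty_iso_dual_ass :
    Nonempty (Operad.Iso (Ass k).dual.operad (Ass k).operad) := by
  -- In the twisted dual, `(12)` sends each coordinate functional to minus the other one; the sign
  -- in `assDual` turns this into a plain interchange.
  have hφ (x) : (assDual k).toLinearMap (assRep k (swap 0 1) x) =
      czechDual (assRep k) (swap 0 1) ((assDual k).toLinearMap x) := by
    ext i
    simp only [assRep_swap]
    fin_cases i <;> simp [assDual, czechDual_swap_apply, assRep_swap]
  refine QuadraticData.nonempty_iso_dual (assDual k) hφ ?_
  rw [Set.image_singleton, freeMap_assocRel]
  refine ann_relSpan_assocRel ?_ ?_ ?_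
  · simp [assDual]
  · simp [assDual, assRep_swap]
  -- By equivariance the two functionals are the images of the two standard basis vectors under the
  -- equivalence `assDual`.
  · rw [← hφ, assRep_single, swap_apply_left, ← Set.image_pair, ← Submodule.map_span,
      Submodule.map_eq_top_iff]
    refine Submodule.eq_top_iff'.2 fun x => Submodule.mem_span_pair.2 ⟨x 0, x 1, ?_⟩
    ext i
    fin_cases i <;> simp

theorem nonempty_iso_dual_com :
    Nonempty (Operad.Iso (Com k).dual.operad (Lie k).operad) := by
  have hφ (x) : (selfDual k).toLinearMap
      (signTwist (Representation.trivial k (Perm (Fin 2)) k) (swap 0 1) x) =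
      czechDual (Representation.trivial k (Perm (Fin 2)) k) (swap 0 1)
        ((selfDual k).toLinearMap x) := by
    ext
    simp [selfDual, czechDual_swap_apply, signTwist_trivial_swap]
  refine QuadraticData.nonempty_iso_dual (selfDual k) hφ ?_
  rw [Set.image_singleton, freeMap_jacobiRel]
  refine ann_relSpan_assocRel_of_comm (by simp) ?_ (by simp [selfDual]) ?_
  · rw [← hφ, signTwist_trivial_swap, map_neg]
  · rw [← Set.image_singleton, ← Submodule.map_span, span_one_eq_top, Submodule.map_top,
      LinearEquiv.range]

theorem nonempty_iso_dual_lie :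
    Nonempty (Operad.Iso (Lie k).dual.operad (Com k).operad) := by
  have hφ (x) : (selfDual k).toLinearMap
      (Representation.trivial k (Perm (Fin 2)) k (swap 0 1) x) =
      czechDual (signTwist (Representation.trivial k (Perm (Fin 2)) k)) (swap 0 1)
        ((selfDual k).toLinearMap x) := by
    ext
    simp [selfDual, czechDual_swap_apply, signTwist_trivial_swap]
  refine QuadraticData.nonempty_iso_dual (selfDual k) hφ ?_
  rw [Set.image_singleton, freeMap_assocRel]
  refine ann_relSpan_jacobiRel (signTwist_trivial_swap k 1) ?_ (by simp [selfDual]) ?_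
  · rw [← hφ]; rfl
  · rw [← Set.image_singleton, ← Submodule.map_span, span_one_eq_top, Submodule.map_top,
      LinearEquiv.range]

theorem nonempty_iso_dual_poiss :
    Nonempty (Operad.Iso (Poiss k).dual.operad (Poiss k).operad) := by
  have hφ (x) : (poissDual k).toLinearMap (poissRep k (swap 0 1) x) =
      czechDual (poissRep k) (swap 0 1) ((poissDual k).toLinearMap x) := by
    ext <;> simp [poissDual, czechDual_swap_apply, poissRep_swap]
  refine QuadraticData.nonempty_iso_dual (poissDual k) hφ ?_
  rw [Set.image_insert_eq, Set.image_pair, freeMap_assocRel, freeMap_jacobiRel,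
    freeMap_distribRel]
  refine ann_relSpan_poisson (by simp [poissRep_swap]) (by simp [poissRep_swap]) ?_ ?_
    (by simp [poissDual]) (by simp [poissDual]) (by simp [poissDual]) (by simp [poissDual]) ?_
  · rw [← hφ, poissRep_swap, neg_zero]
  · rw [← hφ, poissRep_swap, ← map_neg]
    simp
  · rw [← Set.image_pair, ← Submodule.map_span, Submodule.map_eq_top_iff]
    refine Submodule.eq_top_iff'.2 fun x => Submodule.mem_span_pair.2 ⟨x.1, x.2, ?_⟩
    ext <;> simp

end Examples

end QuadOperad

theorem mainTheorem2 (k : Type*) [Field k] [CharZero k] :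
    Nonempty (QuadOperad.Operad.Iso
      (QuadOperad.Ass k).dual.operad (QuadOperad.Ass k).operad) ∧
    Nonempty (QuadOperad.Operad.Iso
      (QuadOperad.Com k).dual.operad (QuadOperad.Lie k).operad) ∧
    Nonempty (QuadOperad.Operad.Iso
      (QuadOperad.Lie k).dual.operad (QuadOperad.Com k).operad) ∧
    Nonempty (QuadOperad.Operad.Iso
      (QuadOperad.Poiss k).dual.operad (QuadOperad.Poiss k).operad) :=
  ⟨QuadOperad.nonempty_iso_dual_ass k, QuadOperad.nonempty_iso_dual_com k,
    QuadOperad.nonempty_iso_dual_lie k, QuadOperad.nonempty_iso_dual_poiss k⟩
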